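/- **Setting.** For every sample size $N\in\mathbb N$ let $P=P_N\in\mathbb N$, let $\mathcal D=\mathcal D_N$ be a probability distribution on $\mathbb R^{P}$ with finite second moments and second moment matrix $\Sigma=\mathbb E_{x\sim\mathcal D}[xx^{\mathsf T}]=\sum_{i=1}^P\lambda_i v_iv_i^{\mathsf T}$ (orthonormal eigenvectors $v_i$), let $\beta=\beta_N\in\mathbb R^{P}$ be deterministic and $\lambda=\lambda_N>0$. Nothing is assumed on how these vary with $N$. Let $x_1,\dots,x_N\sim\mathcal D$ be independent, let $X$ be the $N\times P$ matrix with rows $x_i$, $y_i=\beta^{\mathsf T}x_i$, $\widehat\Sigma=\frac1N X^{\mathsf T}X$, and let $\hat\lambda_1\ge\dots\ge\hat\lambda_N$ be the $N$ largest eigenvalues of $\widehat\Sigma$ (with multiplicity, padded with zeros if $P<N$). * For $\mu>0$, $\kappa=\kappa(\mu,N)$ is the unique positive solution of $1=\frac{\mu}{\kappa}+\frac1N\sum_{i=1}^P\frac{\lambda_i}{\kappa+\lambda_i}$, and $\frac{\partial\kappa}{\partial\mu}$ is its derivative in $\mu$. * $\hat\beta_\lambda=\operatorname{argmin}_{b\in\mathbb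 R^P}\ \frac1N\sum_{i=1}^N(y_i-b^{\mathsf T}x_i)^2+\lambda\|b\|_2^2$, and $\mathcal R(b)=\mathbb E_{x\sim\mathcal D}[(\beta^{\mathsf T}x-b^{\mathsf T}x)^2]$. * $\mathcal R^\lambda_{\mathrm{omni}}=\frac{\partial\kappa}{\partial\lambda}\,\kappa^2\sum_{i=1}^P\frac{\lambda_i}{(\kappa+\lambda_i)^2}(\beta^{\mathsf T}v_i)^2$ with $\kappa=\kappa(\lambda,N)$. **Conventions.** Events $A^N$ occur *with high probability* if for every $D>0$ there is $N_D$ such that $\Pr(A^N)\ge 1-N^{-D}$ for all $N\ge N_D$. We write $f\lesssim N^{-1/2+o(1)}g$ uniformly over $S$ if there are $C>0$ and real $\varepsilon_N\to0$ such that, with high probability, $f^N(z)\le C\,N^{-1/2+\varepsilon_N}g^N(z)$ for all $z\in S=S_N$. **Local Marchenko–Pastur law over $S\subseteq\mathbb R_{>0}$** (for the distributions $\mathcal D=\mathcal D_N$): for every deterministic family $v=v_N\in\mathbb R^{P}$ with $v^{\mathsf T}\Sigma v\le1$, both $$\Big|\frac1\kappa-\frac1N\sum_{i=1}^N\frac1{\hat\lambda_i+\mu}\Big|\lesssim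 N^{-\frac12+o(1)}\,\frac1\kappa\sqrt{\frac{\partial\kappa}{\partial\mu}},\qquad \big|v^{\mathsf T}\kappa(\kappa I+\Sigma)^{-1}v-v^{\mathsf T}\mu(\mu I+\widehat\Sigma)^{-1}v\big|\lesssim N^{-\frac12+o(1)}\,\frac1\kappa\sqrt{\frac{\partial\kappa}{\partial\mu}}$$ hold uniformly over $\mu\in S$, where $\kappa=\kappa(\mu,N)$. **Extended local Marchenko–Pastur law over $S$:** for every deterministic family $t=t_N\in\mathbb R$ with $|t_N|\,\|\Sigma\|_{\mathrm{op}}<\frac12$, the local Marchenko–Pastur law over $S$ holds for the distributions of $(I+t_N\Sigma)^{-1/2}x$, $x\sim\mathcal D_N$ (with $\Sigma$, $\widehat\Sigma$, $\hat\lambda_i$, $\kappa$ in the law computed for the transformed distribution). **Proposition.** If the extended local Marchenko–Pastur law holds over $S=(\frac12\lambda,\frac32\lambda)$, then $$\big|\mathcal R^\lambda_{\mathrm{omni}}-\mathcal R(\hat\beta_\lambda)\big|\lesssim N^{-\frac12+o(1)}\cdot\beta^{\mathsf T}\Sigma\beta\cdot\frac{\|\Sigma\|_{\mathrm{op}}}{\lambda}.$$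 -/

import Mathlib

open MeasureTheory Filter Topology Matrix

namespace RidgeRisk

noncomputable section

/-! ### Asymptotic conventions

A family of random objects indexed by the sample size `N` lives on probability spaces `(Ω N, μ N)`. -/

/-- The events `A N` occur with high probability: for each `D > 0`, for all large `N`, the event
`A N` fails with probability at most `N ^ (-D)`. -/
def WithHighProb {Ω : ℕ → Type*} [∀ N, MeasurableSpace (Ω N)] (μ : ∀ N, Measure (Ω N))
    (A : ∀ N, Set (Ω N)) : Prop :=
  ∀ D : ℝ, 0 < D → ∃ N₀ : ℕ, ∀ N : ℕ, N₀ ≤ N → μ N (A N)ᶜ ≤ ENNReal.ofReal ((N : ℝ) ^ (-D))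

/-- `f ≲ g` uniformly over `S`: there is a constant `C > 0` such that, with high probability,
`f N z ≤ C * g N z` simultaneously for all `z ∈ S N`. -/
def UnifLesssim {Ω : ℕ → Type*} [∀ N, MeasurableSpace (Ω N)] (μ : ∀ N, Measure (Ω N))
    {Z : Type*} (S : ℕ → Set Z) (f : ∀ N, Ω N → Z → ℝ) (g : ℕ → Z → ℝ) : Prop :=
  ∃ C : ℝ, 0 < C ∧ WithHighProb μ fun N => {ω | ∀ z ∈ S N, f N ω z ≤ C * g N z}

/-- `f ≲ N ^ (-1/2 + o(1)) * g` uniformly over `S`. -/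
def UnifLesssimRate {Ω : ℕ → Type*} [∀ N, MeasurableSpace (Ω N)] (μ : ∀ N, Measure (Ω N))
    {Z : Type*} (S : ℕ → Set Z) (f : ∀ N, Ω N → Z → ℝ) (g : ℕ → Z → ℝ) : Prop :=
  ∃ ε : ℕ → ℝ, Tendsto ε atTop (𝓝 0) ∧
    UnifLesssim μ S f fun N z => (N : ℝ) ^ (-(1 / 2) + ε N) * g N z

/-! ### The population -/

/-- The (uncentered) second moment matrix `Σ = E[x xᵀ]`. -/
def secondMoment {P : ℕ} (D : Measure (Fin P → ℝ)) : Matrix (Fin P) (Fin P) ℝ :=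
  Matrix.of fun i j => ∫ x, x i * x j ∂D

theorem secondMoment_isHermitian {P : ℕ} (D : Measure (Fin P → ℝ)) :
    (secondMoment D).IsHermitian := by
  ext i j
  simp [secondMoment, mul_comm]

/-- The eigenvalues of `Σ`, with multiplicity. -/
def popEigenvalue {P : ℕ} (D : Measure (Fin P → ℝ)) : Fin P → ℝ :=
  (secondMoment_isHermitian D).eigenvalues

/-- An orthonormal family of eigenvectors of `Σ`, matching `popEigenvalue`. -/
def popEigenvector {P : ℕ} (D : Measure (Fin P → ℝ)) (i : Fin P) : Fin P → ℝ :=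
  fun j => (secondMoment_isHermitian D).eigenvectorBasis i j

/-- The Euclidean operator norm of a square matrix. -/
def opNorm {P : ℕ} (A : Matrix (Fin P) (Fin P) ℝ) : ℝ :=
  ‖Matrix.toEuclideanCLM (n := Fin P) (𝕜 := ℝ) A‖

/-- The equation that defines the effective regularization `κ = k`. -/
def IsEffectiveReg {P : ℕ} (D : Measure (Fin P → ℝ)) (N : ℕ) (lam k : ℝ) : Prop :=
  0 < k ∧ 1 = lam / k + 1 / (N : ℝ) * ∑ i, popEigenvalue D i / (k + popEigenvalue D i)

/-- The effective regularization `κ(lam, N)`, the (unique) positive solution of its equation. -/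
def effectiveReg {P : ℕ} (D : Measure (Fin P → ℝ)) (N : ℕ) (lam : ℝ) : ℝ :=
  Classical.epsilon (IsEffectiveReg D N lam)

/-- The partial derivative `∂κ/∂lam` at `lam`. -/
def effectiveRegDeriv {P : ℕ} (D : Measure (Fin P → ℝ)) (N : ℕ) (lam : ℝ) : ℝ :=
  deriv (effectiveReg D N) lam

/-- The generalization risk `E[(βᵀx - bᵀx)²]` of an estimator `b` of `β`. -/
def risk {P : ℕ} (D : Measure (Fin P → ℝ)) (β b : Fin P → ℝ) : ℝ :=
  ∫ x, (β ⬝ᵥ x - b ⬝ᵥ x) ^ 2 ∂D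

/-- The omniscient risk estimate. -/
def omniRisk {P : ℕ} (D : Measure (Fin P → ℝ)) (β : Fin P → ℝ) (N : ℕ) (lam : ℝ) : ℝ :=
  effectiveRegDeriv D N lam * effectiveReg D N lam ^ 2 *
    ∑ i, popEigenvalue D i / (effectiveReg D N lam + popEigenvalue D i) ^ 2 *
      (β ⬝ᵥ popEigenvector D i) ^ 2

/-! ### The sample -/

/-- The law of a sample of `N` independent covariates with distribution `D`. -/
def sampleLaw {P : ℕ} (D : Measure (Fin P → ℝ)) (N : ℕ) : Measure (Fin N → Fin P → ℝ) :=
  Measure.pi fun _ => D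

/-- The empirical second moment matrix `N⁻¹ XᵀX`, where `X` has the rows `X i`. -/
def empSecondMoment {P N : ℕ} (X : Fin N → Fin P → ℝ) : Matrix (Fin P) (Fin P) ℝ :=
  (1 / (N : ℝ)) • ((Matrix.of X)ᵀ * Matrix.of X)

theorem empSecondMoment_isHermitian {P N : ℕ} (X : Fin N → Fin P → ℝ) :
    (empSecondMoment X).IsHermitian := by
  ext i j
  simp [empSecondMoment, Matrix.mul_apply, mul_comm]

/-- The `N` largest eigenvalues of the empirical second moment matrix, in decreasing order; the
list of its `P` eigenvalues is continued by zeros if `P < N`. -/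
def empEigenvalue {P N : ℕ} (X : Fin N → Fin P → ℝ) (i : Fin N) : ℝ :=
  if h : (i : ℕ) < P then
    (empSecondMoment_isHermitian X).eigenvalues₀ ⟨i, by simpa using h⟩
  else 0

/-- The ridge regression objective for the data `(X, y)`. -/
def ridgeObjective {P N : ℕ} (X : Fin N → Fin P → ℝ) (y : Fin N → ℝ) (lam : ℝ)
    (b : Fin P → ℝ) : ℝ :=
  1 / (N : ℝ) * ∑ i, (y i - b ⬝ᵥ X i) ^ 2 + lam * ∑ j, b j ^ 2

/-- The ridge regression estimator, the (for `lam > 0` unique) minimizer of the objective. -/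
def ridgeEstimator {P N : ℕ} (X : Fin N → Fin P → ℝ) (y : Fin N → ℝ) (lam : ℝ) : Fin P → ℝ :=
  Classical.epsilon fun b => IsMinOn (ridgeObjective X y lam) Set.univ b

/-- The noiseless labels `y i = βᵀ x i`. -/
def labels {P N : ℕ} (β : Fin P → ℝ) (X : Fin N → Fin P → ℝ) : Fin N → ℝ :=
  fun i => β ⬝ᵥ X i

/-! ### The local Marchenko-Pastur law -/

/-- The local Marchenko-Pastur law over `S` for the covariate distributions `D N`: for every
deterministic `v` with `vᵀΣv ≤ 1`, the averaged law and the law for the quadratic form of `v` hold,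
each with the error `N ^ (-1/2 + o(1)) * κ⁻¹ * √(∂κ/∂lam)`, uniformly over `lam ∈ S`. -/
def LocalMPLaw {P : ℕ → ℕ} (D : ∀ N, Measure (Fin (P N) → ℝ)) (S : ℕ → Set ℝ) : Prop :=
  ∀ v : ∀ N, Fin (P N) → ℝ, (∀ N, v N ⬝ᵥ (secondMoment (D N) *ᵥ v N) ≤ 1) →
    UnifLesssimRate (fun N => sampleLaw (D N) N) S
      (fun N X lam => |1 / effectiveReg (D N) N lam
        - 1 / (N : ℝ) * ∑ i, 1 / (empEigenvalue X i + lam)|)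
      (fun N lam => 1 / effectiveReg (D N) N lam * √(effectiveRegDeriv (D N) N lam)) ∧
    UnifLesssimRate (fun N => sampleLaw (D N) N) S
      (fun N X lam =>
        |v N ⬝ᵥ ((effectiveReg (D N) N lam •
            (effectiveReg (D N) N lam • (1 : Matrix (Fin (P N)) (Fin (P N)) ℝ)
              + secondMoment (D N))⁻¹) *ᵥ v N)
          - v N ⬝ᵥ ((lam •
            (lam • (1 : Matrix (Fin (P N)) (Fin (P N)) ℝ) + empSecondMoment X)⁻¹) *ᵥ v N)|)
      (fun N lam => 1 / effectiveReg (D N) N lam * √(effectiveRegDeriv (D N) N lam))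

/-- The matrix `(I + tΣ) ^ (-1/2)`, by the functional calculus of the symmetric matrix `Σ`. -/
def whitener {P : ℕ} (D : Measure (Fin P → ℝ)) (t : ℝ) : Matrix (Fin P) (Fin P) ℝ :=
  (secondMoment_isHermitian D).cfc fun s => (1 + t * s) ^ (-(1 / 2) : ℝ)

/-- The law of `(I + tΣ) ^ (-1/2) x` for `x` with the law `D`. -/
def transformedLaw {P : ℕ} (D : Measure (Fin P → ℝ)) (t : ℝ) : Measure (Fin P → ℝ) :=
  D.map fun x => whitener D t *ᵥ x

/-- The extended local Marchenko-Pastur law over `S`: the local Marchenko-Pastur law holds for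
`(I + tΣ) ^ (-1/2) x`, uniformly over the `t` with `|t| < ‖Σ‖⁻¹ / 2`. The uniformity in `t` is
expressed by letting the deterministic `t`, as `v` in the law itself, vary freely with `N`. The
strict inequality is multiplied out, so that every `t` is admitted if `Σ = 0`. -/
def ExtendedLocalMPLaw {P : ℕ → ℕ} (D : ∀ N, Measure (Fin (P N) → ℝ)) (S : ℕ → Set ℝ) : Prop :=
  ∀ t : ℕ → ℝ, (∀ N, |t N| * opNorm (secondMoment (D N)) < 1 / 2) →
    LocalMPLaw (fun N => transformedLaw (D N) (t N)) S

end

end RidgeRisk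

/-! Write `s` for the operator norm of `Σ`, `q = βᵀΣβ`, and consider the sample quadratic form `F(t)
= βᵀ(1 + tΣ + λ⁻¹Σ̂)⁻¹β`. Since `β - β̂ = (1 + λ⁻¹Σ̂)⁻¹β`, the risk of the ridge estimator is
`-F'(0)`. Conjugating by `(1 + tΣ)^(-1/2)` turns `F(t)` into the quadratic form in the local law for
the transformed covariates, at the vector `(1 + tΣ)^(-1/2)β`. The deterministic counterpart is `G(t)
= ∑ (βᵀvᵢ)² / (1 + (t + 1/κ_t)λᵢ)`, and implicit differentiation of the fixed point equation gives
`G'(0) = -omniRisk` (`hasDerivAt_population`). The law gives `|F(t) - G(t)| ≲ N^(-1/2+o(1)) q/λ` for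
each admissible deterministic `t` (`measure_node_le`, with `errorScale_le`).

Closeness of values must be upgraded to closeness of derivatives. Subtract `βᵀ(1 + tΣ)⁻¹β` from both
functions: `βᵀβ` is not controlled by `q/λ`, but the differences are. Each difference is a
polynomial of degree below `n` up to a remainder of order `(s|t|)^n`. For `G` this comes from Cauchy
estimates for a holomorphic fixed point iteration (`exists_taylor_fixedInv`). For `F` it comes from
resolvent identities in which `β` enters the remainder only through `X Σ^j β` and `X Σ^j (1 + tΣ)⁻¹
β` (`abs_resolvent_sub_taylor_le`); Markov's inequality bounds these by a power of `N`.

Evaluation at `n` equally spaced nodes of size about `x/s`, `x = N^(-η/4)`, and inversion of a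
Vandermonde matrix recover the linear coefficients with a loss `s/x` (`abs_omniRisk_sub_risk_le`).
This loss is the factor `s` in the bound. For `n` large, `x^n` beats the power of `N` lost to
Markov. A union bound over finitely many events and a diagonal choice of `η` conclude. -/

namespace RidgeRisk

/-! ### The fixed point equation of the effective regularization -/

/-- The sum `c * ∑ σ i / (1 + s σ i)`, a Stieltjes-type function of `s`. -/
noncomputable def stieltjesSum {ι : Type*} [Fintype ι] (c : ℝ) (σ : ι → ℝ) (s : ℝ) : ℝ :=
  c * ∑ i, σ i / (1 + s * σ i)

/-- The equation for `w = 1 / κ`, where the spectrum is `σ / (1 + t σ)`. -/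
def IsFixedInv {ι : Type*} [Fintype ι] (c : ℝ) (σ : ι → ℝ) (t μ w : ℝ) : Prop :=
  0 < w ∧ w * (μ + stieltjesSum c σ (t + w)) = 1

/-- The mixed second order sum that governs differences of solutions. -/
noncomputable def mixedSum {ι : Type*} [Fintype ι] (c : ℝ) (σ : ι → ℝ) (w₁ w₂ s₁ s₂ : ℝ) : ℝ :=
  w₁ * w₂ * (c * ∑ i, σ i ^ 2 / ((1 + s₁ * σ i) * (1 + s₂ * σ i)))

section

variable {ι : Type*} [Fintype ι] {c : ℝ} {σ : ι → ℝ}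

theorem one_add_pos {t w : ℝ} {x : ℝ} (hx : 0 ≤ x) (ht : 1 / 2 ≤ 1 + t * x) (hw : 0 ≤ w) :
    0 < 1 + (t + w) * x := by nlinarith [mul_nonneg hw hx]

theorem stieltjesSum_nonneg (hc : 0 ≤ c) (hσ : ∀ i, 0 ≤ σ i) {t w : ℝ}
    (ht : ∀ i, 1 / 2 ≤ 1 + t * σ i) (hw : 0 ≤ w) : 0 ≤ stieltjesSum c σ (t + w) :=
  mul_nonneg hc (Finset.sum_nonneg fun i _ =>
    div_nonneg (hσ i) (one_add_pos (hσ i) (ht i) hw).le)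

theorem stieltjesSum_le (hc : 0 ≤ c) (hσ : ∀ i, 0 ≤ σ i) {t w : ℝ}
    (ht : ∀ i, 1 / 2 ≤ 1 + t * σ i) (hw : 0 ≤ w) :
    stieltjesSum c σ (t + w) ≤ stieltjesSum c σ t := by
  refine mul_le_mul_of_nonneg_left (Finset.sum_le_sum fun i _ => ?_) hc
  refine div_le_div_of_nonneg_left (hσ i) (by linarith [ht i]) ?_
  nlinarith [mul_nonneg hw (hσ i)]

theorem stieltjesSum_sub {s₁ s₂ : ℝ} (h₁ : ∀ i, 0 < 1 + s₁ * σ i) (h₂ : ∀ i, 0 < 1 + s₂ * σ i) :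
    stieltjesSum c σ s₁ - stieltjesSum c σ s₂
      = (s₂ - s₁) * (c * ∑ i, σ i ^ 2 / ((1 + s₁ * σ i) * (1 + s₂ * σ i))) := by
  unfold stieltjesSum
  rw [← mul_sub, ← Finset.sum_sub_distrib, mul_left_comm]
  congr 1
  rw [Finset.mul_sum]
  refine Finset.sum_congr rfl fun i _ => ?_
  have h₃ := (h₁ i).ne'
  have h₄ := (h₂ i).ne'
  rw [div_sub_div _ _ h₃ h₄, mul_div_assoc']
  congr 1
  ring

theorem mixedSum_nonneg (hc : 0 ≤ c) {w₁ w₂ s₁ s₂ : ℝ} (hw₁ : 0 ≤ w₁) (hw₂ : 0 ≤ w₂)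
    (h₁ : ∀ i, 0 < 1 + s₁ * σ i) (h₂ : ∀ i, 0 < 1 + s₂ * σ i) :
    0 ≤ mixedSum c σ w₁ w₂ s₁ s₂ :=
  mul_nonneg (mul_nonneg hw₁ hw₂) (mul_nonneg hc (Finset.sum_nonneg fun i _ =>
    div_nonneg (sq_nonneg _) (mul_pos (h₁ i) (h₂ i)).le))

/-- One factor of each summand can be dropped because `w₂ σ ≤ 1 + (t₂ + w₂) σ`. -/
theorem mixedSum_le (hc : 0 ≤ c) (hσ : ∀ i, 0 ≤ σ i) {w₁ w₂ s₁ t₂ : ℝ}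
    (hw₁ : 0 ≤ w₁) (hw₂ : 0 ≤ w₂) (h₁ : ∀ i, 0 < 1 + s₁ * σ i)
    (h₂ : ∀ i, 1 / 2 ≤ 1 + t₂ * σ i) :
    mixedSum c σ w₁ w₂ s₁ (t₂ + w₂) ≤ w₁ * stieltjesSum c σ s₁ := by
  unfold mixedSum stieltjesSum
  rw [mul_assoc]
  refine mul_le_mul_of_nonneg_left ?_ hw₁
  rw [mul_left_comm]
  refine mul_le_mul_of_nonneg_left ?_ hc
  rw [Finset.mul_sum]
  refine Finset.sum_le_sum fun i _ => ?_
  have h := one_add_pos (hσ i) (h₂ i) hw₂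
  rw [sq, mul_div_mul_comm, mul_left_comm]
  refine mul_le_of_le_one_right (div_nonneg (hσ i) (h₁ i).le) ?_
  rw [mul_div_assoc', div_le_one h]
  nlinarith [h₂ i]

theorem IsFixedInv.le (hc : 0 ≤ c) (hσ : ∀ i, 0 ≤ σ i) {t μ w : ℝ}
    (ht : ∀ i, 1 / 2 ≤ 1 + t * σ i) (h : IsFixedInv c σ t μ w) : w * μ ≤ 1 := by
  nlinarith [h.2, mul_nonneg h.1.le (stieltjesSum_nonneg hc hσ ht h.1.le)]

/-- Subtracting the two equations gives an exact divided-difference identity. It serves three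
purposes: stability of the solution, its derivative in `t`, and its derivative in `μ`. -/
theorem IsFixedInv.sub_eq (hσ : ∀ i, 0 ≤ σ i) {t₁ t₂ μ₁ μ₂ w₁ w₂ : ℝ}
    (ht₁ : ∀ i, 1 / 2 ≤ 1 + t₁ * σ i) (ht₂ : ∀ i, 1 / 2 ≤ 1 + t₂ * σ i)
    (h₁ : IsFixedInv c σ t₁ μ₁ w₁) (h₂ : IsFixedInv c σ t₂ μ₂ w₂) :
    (w₂ - w₁) * (1 - mixedSum c σ w₁ w₂ (t₁ + w₁) (t₂ + w₂))
      = w₁ * w₂ * (μ₁ - μ₂) + (t₂ - t₁) * mixedSum c σ w₁ w₂ (t₁ + w₁) (t₂ + w₂) := by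
  have e := stieltjesSum_sub (c := c) (fun i => one_add_pos (hσ i) (ht₁ i) h₁.1.le)
    (fun i => one_add_pos (hσ i) (ht₂ i) h₂.1.le)
  have e' : w₂ - w₁ = w₁ * w₂ * (μ₁ - μ₂)
      + w₁ * w₂ * (stieltjesSum c σ (t₁ + w₁) - stieltjesSum c σ (t₂ + w₂)) := by
    linear_combination (-w₂) * h₁.2 + w₁ * h₂.2
  rw [e] at e'
  unfold mixedSum
  linear_combination e'

/-- The mixed sum is at most `w₁ * stieltjesSum c σ (t₁ + w₁)`, which the equation identifies as `1
- w₁ μ₁`. This keeps the coefficient in `IsFixedInv.sub_eq` away from zero. -/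
theorem IsFixedInv.one_sub_mixedSum (hc : 0 ≤ c) (hσ : ∀ i, 0 ≤ σ i) {t₁ t₂ μ₁ μ₂ w₁ w₂ : ℝ}
    (ht₁ : ∀ i, 1 / 2 ≤ 1 + t₁ * σ i) (ht₂ : ∀ i, 1 / 2 ≤ 1 + t₂ * σ i)
    (h₁ : IsFixedInv c σ t₁ μ₁ w₁) (h₂ : IsFixedInv c σ t₂ μ₂ w₂) :
    w₁ * μ₁ ≤ 1 - mixedSum c σ w₁ w₂ (t₁ + w₁) (t₂ + w₂) := by
  have := mixedSum_le hc hσ h₁.1.le h₂.1.le (fun i => one_add_pos (hσ i) (ht₁ i) h₁.1.le) ht₂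
  linarith [h₁.2]

/-- Stability of the solution in the parameters. -/
theorem IsFixedInv.abs_sub_le (hc : 0 ≤ c) (hσ : ∀ i, 0 ≤ σ i) {t₁ t₂ μ₁ μ₂ w₁ w₂ : ℝ}
    (hμ₁ : 0 < μ₁)
    (ht₁ : ∀ i, 1 / 2 ≤ 1 + t₁ * σ i) (ht₂ : ∀ i, 1 / 2 ≤ 1 + t₂ * σ i)
    (h₁ : IsFixedInv c σ t₁ μ₁ w₁) (h₂ : IsFixedInv c σ t₂ μ₂ w₂) :
    w₁ * μ₁ * |w₂ - w₁| ≤ w₁ * w₂ * |μ₁ - μ₂| + |t₂ - t₁| := by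
  have e := h₁.sub_eq hσ ht₁ ht₂ h₂
  have hQ := h₁.one_sub_mixedSum hc hσ ht₁ ht₂ h₂
  have hQ0 : 0 ≤ mixedSum c σ w₁ w₂ (t₁ + w₁) (t₂ + w₂) :=
    mixedSum_nonneg hc h₁.1.le h₂.1.le (fun i => one_add_pos (hσ i) (ht₁ i) h₁.1.le)
      (fun i => one_add_pos (hσ i) (ht₂ i) h₂.1.le)
  have hwm := mul_pos h₁.1 hμ₁
  set Q := mixedSum c σ w₁ w₂ (t₁ + w₁) (t₂ + w₂)
  calc w₁ * μ₁ * |w₂ - w₁| ≤ (1 - Q) * |w₂ - w₁| :=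
        mul_le_mul_of_nonneg_right hQ (abs_nonneg _)
    _ = |(w₂ - w₁) * (1 - Q)| := by
        rw [abs_mul, abs_of_nonneg (by linarith : 0 ≤ 1 - Q), mul_comm]
    _ = |w₁ * w₂ * (μ₁ - μ₂) + (t₂ - t₁) * Q| := by rw [e]
    _ ≤ |w₁ * w₂ * (μ₁ - μ₂)| + |(t₂ - t₁) * Q| := abs_add_le _ _
    _ ≤ w₁ * w₂ * |μ₁ - μ₂| + |t₂ - t₁| := by
        rw [abs_mul, abs_of_pos (mul_pos h₁.1 h₂.1), abs_mul, abs_of_nonneg hQ0]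
        gcongr
        exact mul_le_of_le_one_right (abs_nonneg _) (by linarith)

theorem exists_isFixedInv (hc : 0 ≤ c) (hσ : ∀ i, 0 ≤ σ i) {t μ : ℝ} (hμ : 0 < μ)
    (ht : ∀ i, 1 / 2 ≤ 1 + t * σ i) : ∃ w, IsFixedInv c σ t μ w := by
  have hcont : ContinuousOn (fun w => w * (μ + stieltjesSum c σ (t + w))) (Set.Icc 0 (1 / μ)) := by
    unfold stieltjesSum
    refine continuousOn_id.mul (continuousOn_const.add (continuousOn_const.mul
      (continuousOn_finsetSum _ fun i _ => ContinuousOn.div continuousOn_const (by fun_prop) ?_)))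
    intro w hw
    exact (one_add_pos (hσ i) (ht i) hw.1).ne'
  have hm := stieltjesSum_nonneg hc hσ ht (one_div_pos.2 hμ).le
  obtain ⟨w, hw, h⟩ := intermediate_value_Icc (one_div_pos.2 hμ).le hcont
    (show (1 : ℝ) ∈ _ by
      refine ⟨by simp, ?_⟩
      have : 1 / μ * μ = 1 := by field_simp
      nlinarith [mul_nonneg (one_div_pos.2 hμ).le hm])
  refine ⟨w, lt_of_le_of_ne hw.1 ?_, h⟩
  rintro rfl
  simp at h

/-- The fixed point iteration contracts towards the solution. -/
theorem IsFixedInv.iterate_sub_le (hc : 0 ≤ c) (hσ : ∀ i, 0 ≤ σ i) {t μ w x : ℝ} (hμ : 0 < μ)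
    (ht : ∀ i, 1 / 2 ≤ 1 + t * σ i) (h : IsFixedInv c σ t μ w) (hx : 0 ≤ x) :
    |1 / (μ + stieltjesSum c σ (t + x)) - w| ≤ (1 - μ / (μ + stieltjesSum c σ t)) * |x - w| := by
  have hm := stieltjesSum_nonneg hc hσ ht hx
  have hm' := stieltjesSum_le hc hσ ht hx
  have hp : 0 < μ + stieltjesSum c σ (t + x) := by linarith
  set y := 1 / (μ + stieltjesSum c σ (t + x)) with hy
  have hy0 : 0 < y := one_div_pos.2 hp
  have hy1 : y * (μ + stieltjesSum c σ (t + x)) = 1 := by rw [hy]; field_simp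
  have e := stieltjesSum_sub (c := c) (fun i => one_add_pos (hσ i) (ht i) hx)
    (fun i => one_add_pos (hσ i) (ht i) h.1.le)
  have hQ := mixedSum_le hc hσ hy0.le h.1.le (fun i => one_add_pos (hσ i) (ht i) hx) ht
  have hQ0 := mixedSum_nonneg hc hy0.le h.1.le (fun i => one_add_pos (hσ i) (ht i) hx)
    (fun i => one_add_pos (hσ i) (ht i) h.1.le)
  have e' : y - w = mixedSum c σ y w (t + x) (t + w) * (x - w) := by
    have : y - w = y * w * (stieltjesSum c σ (t + w) - stieltjesSum c σ (t + x)) := by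
      linear_combination w * hy1 - y * h.2
    rw [← neg_sub (stieltjesSum c σ (t + x)), e] at this
    unfold mixedSum
    linear_combination this
  rw [e', abs_mul, abs_of_nonneg hQ0]
  refine mul_le_mul_of_nonneg_right ?_ (abs_nonneg _)
  -- The mixed sum is at most `1 - y μ`. The sum decreases in its argument, so `y` is bounded below
  -- by its value at `x = 0`, which makes the contraction factor independent of `x`.
  have : μ / (μ + stieltjesSum c σ t) ≤ y * μ := by
    rw [hy, div_mul_eq_mul_div, one_mul]
    exact div_le_div_of_nonneg_left hμ.le hp (by linarith)
  linarith

/-- Carathéodory's form of the derivative: a continuous divided difference suffices. -/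
theorem hasDerivAt_of_eq_add_mul {f g : ℝ → ℝ} {a : ℝ} (hg : ContinuousAt g a)
    (h : ∀ᶠ x in 𝓝 a, f x = f a + (x - a) * g x) : HasDerivAt f (g a) a := by
  rw [hasDerivAt_iff_tendsto_slope]
  refine (hg.tendsto.mono_left nhdsWithin_le_nhds).congr' ?_
  filter_upwards [h.filter_mono nhdsWithin_le_nhds, self_mem_nhdsWithin] with x hx hxa
  have : x - a ≠ 0 := sub_ne_zero.2 hxa
  rw [slope_def_field, hx]
  field_simp
  ring

theorem continuousAt_mixedSum {α : Type*} [TopologicalSpace α] {w₂ s₂ : α → ℝ} {a : α} {w₁ s₁ : ℝ}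
    (hw : ContinuousAt w₂ a) (hs : ContinuousAt s₂ a) (h₁ : ∀ i, 0 < 1 + s₁ * σ i)
    (h₂ : ∀ i, 0 < 1 + s₂ a * σ i) :
    ContinuousAt (fun x => mixedSum c σ w₁ (w₂ x) s₁ (s₂ x)) a := by
  unfold mixedSum
  refine (continuousAt_const.mul hw).mul (continuousAt_const.mul ?_)
  refine tendsto_finsetSum _ fun i _ => ?_
  refine ContinuousAt.div continuousAt_const (by fun_prop) ?_
  exact (mul_pos (h₁ i) (h₂ i)).ne'

/-- No regularity of `w` is assumed. Stability at equal `μ` gives `w 0 * μ * |w t - w 0| ≤ |t|`. -/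
theorem continuousAt_fixedInv (hc : 0 ≤ c) (hσ : ∀ i, 0 ≤ σ i) {w : ℝ → ℝ} {μ : ℝ} (hμ : 0 < μ)
    (hw : ∀ᶠ t in 𝓝 (0 : ℝ), (∀ i, 1 / 2 ≤ 1 + t * σ i) ∧ IsFixedInv c σ t μ (w t)) :
    ContinuousAt w 0 := by
  have h0 := hw.self_of_nhds
  have hp := mul_pos h0.2.1 hμ
  have hlim : Tendsto (fun t : ℝ => |t| / (w 0 * μ)) (𝓝 0) (𝓝 0) := by
    have : ContinuousAt (fun t : ℝ => |t| / (w 0 * μ)) 0 := by fun_prop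
    simpa [ContinuousAt] using this
  refine tendsto_iff_dist_tendsto_zero.2 (squeeze_zero' (Eventually.of_forall fun _ => dist_nonneg)
    ?_ hlim)
  filter_upwards [hw] with t ht
  have := h0.2.abs_sub_le hc hσ hμ h0.1 ht.1 ht.2
  rw [Real.dist_eq, le_div_iff₀ hp, mul_comm]
  simpa using this

/-- The derivative in `t` of the deterministic quadratic form. -/
theorem hasDerivAt_sum_fixedInv (hc : 0 ≤ c) (hσ : ∀ i, 0 ≤ σ i) (b : ι → ℝ) {w : ℝ → ℝ} {μ : ℝ}
    (hμ : 0 < μ)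
    (hw : ∀ᶠ t in 𝓝 (0 : ℝ), (∀ i, 1 / 2 ≤ 1 + t * σ i) ∧ IsFixedInv c σ t μ (w t)) :
    HasDerivAt (fun t => ∑ i, b i / (1 + (t + w t) * σ i))
      (-((1 - mixedSum c σ (w 0) (w 0) (w 0) (w 0))⁻¹ * ∑ i, b i * σ i / (1 + w 0 * σ i) ^ 2)) 0 := by
  have h0 := hw.self_of_nhds
  have hcw := continuousAt_fixedInv hc hσ hμ hw
  have hpos : ∀ i, 0 < 1 + w 0 * σ i := fun i => by
    simpa using one_add_pos (hσ i) (h0.1 i) h0.2.1.le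
  have hcs : ContinuousAt (fun t => t + w t) 0 := continuousAt_id.add hcw
  have hQc := continuousAt_mixedSum (c := c) (σ := σ) (w₁ := w 0) (s₁ := w 0) hcw hcs hpos
    (by simpa using hpos)
  have hQ0 := h0.2.one_sub_mixedSum hc hσ h0.1 h0.1 h0.2
  simp only [zero_add] at hQ0
  have hQ1 : 1 - mixedSum c σ (w 0) (w 0) (w 0) (w 0) ≠ 0 :=
    (lt_of_lt_of_le (mul_pos h0.2.1 hμ) hQ0).ne'
  have key : ContinuousAt (fun t => -((1 - mixedSum c σ (w 0) (w t) (w 0) (t + w t))⁻¹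
      * ∑ i, b i * σ i / ((1 + w 0 * σ i) * (1 + (t + w t) * σ i)))) 0 := by
    refine ((ContinuousAt.inv₀ (continuousAt_const.sub hQc) (by simpa using hQ1)).mul ?_).neg
    refine tendsto_finsetSum _ fun i _ => ?_
    refine ContinuousAt.div continuousAt_const (by fun_prop) ?_
    simpa using (mul_pos (hpos i) (hpos i)).ne'
  have := hasDerivAt_of_eq_add_mul (f := fun t => ∑ i, b i / (1 + (t + w t) * σ i)) key ?_
  · simpa [sq] using this
  filter_upwards [hw] with t ht
  have hpt : ∀ i, 0 < 1 + (t + w t) * σ i := fun i => one_add_pos (hσ i) (ht.1 i) ht.2.1.le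
  have e := h0.2.sub_eq hσ h0.1 ht.1 ht.2
  have hQt := h0.2.one_sub_mixedSum hc hσ h0.1 ht.1 ht.2
  simp only [zero_add, sub_self, mul_zero, sub_zero] at e hQt ⊢
  have hQt' : 1 - mixedSum c σ (w 0) (w t) (w 0) (t + w t) ≠ 0 :=
    (lt_of_lt_of_le (mul_pos h0.2.1 hμ) hQt).ne'
  -- The increment of the total shift `t + w t`: adding `t (1 - Q)` to `(w t - w 0)(1 - Q) = t Q`
  -- leaves `t`.
  have hs : t * (1 - mixedSum c σ (w 0) (w t) (w 0) (t + w t))⁻¹ = t + w t - w 0 := by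
    field_simp
    linear_combination -e
  rw [mul_neg, ← mul_assoc, hs, ← sub_eq_add_neg, eq_sub_iff_add_eq, Finset.mul_sum,
    ← Finset.sum_add_distrib]
  refine Finset.sum_congr rfl fun i _ => ?_
  have h₁ := (hpos i).ne'
  have h₂ := (hpt i).ne'
  have h₃ : (t + w t - w 0) * σ i = (1 + (t + w t) * σ i) - (1 + w 0 * σ i) := by ring
  generalize 1 + w 0 * σ i = p at *
  generalize 1 + (t + w t) * σ i = q at *
  field_simp
  linear_combination b i * h₃

end

/-! ### Taylor polynomials of the deterministic quadratic form -/

/-- Cauchy estimates on the circle of radius `1 / (2 * s)` bound the coefficients. The tail is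
geometric with ratio `2 * s * |t| ≤ 1 / 2`, hence the factor 2. -/
theorem exists_real_taylor_of_bounded {f : ℂ → ℂ} {s M : ℝ} (hs : 0 < s)
    (hf : DifferentiableOn ℂ f (Metric.ball 0 (1 / s)))
    (hM : ∀ z : ℂ, ‖z‖ ≤ 1 / (2 * s) → ‖f z‖ ≤ M) :
    ∃ a : ℕ → ℝ, (∀ m, |a m| ≤ M * (2 * s) ^ m) ∧ ∀ (n : ℕ) (t : ℝ), |t| ≤ 1 / (4 * s) →
      |(f t).re - ∑ m ∈ Finset.range n, a m * t ^ m| ≤ 2 * M * (2 * s * |t|) ^ n := by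
  have hR : 0 < 1 / (2 * s) := by positivity
  have hlt : 1 / (2 * s) < 1 / s := one_div_lt_one_div_of_lt hs (by linarith)
  have hsub : Metric.closedBall (0 : ℂ) (1 / (2 * s)) ⊆ Metric.ball 0 (1 / s) :=
    Metric.closedBall_subset_ball hlt
  have hM0 : 0 ≤ M := (norm_nonneg _).trans (hM 0 (by simpa using hs.le))
  have hd : DiffContOnCl ℂ f (Metric.ball 0 (1 / (2 * s))) := hf.diffContOnCl_ball hsub
  have hco : ∀ m : ℕ, ‖((m.factorial : ℂ))⁻¹ * iteratedDeriv m f 0‖ ≤ M * (2 * s) ^ m := by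
    intro m
    have h := Complex.norm_iteratedDeriv_le_of_forall_mem_sphere_norm_le m hR hd
      (C := M) (fun z hz => hM z (by simpa using (mem_sphere_iff_norm.1 hz).le))
    have hfac : (0 : ℝ) < m.factorial := by exact_mod_cast m.factorial_pos
    rw [norm_mul, norm_inv, Complex.norm_natCast, inv_mul_le_iff₀ hfac]
    refine h.trans (le_of_eq ?_)
    rw [div_pow, one_pow, div_div_eq_mul_div, div_one, mul_assoc]
  refine ⟨fun m => (((m.factorial : ℂ))⁻¹ * iteratedDeriv m f 0).re,
    fun m => (Complex.abs_re_le_norm _).trans (hco m), fun n t ht => ?_⟩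
  have hx : 2 * s * |t| ≤ 1 / 2 := by
    rw [le_div_iff₀ (by positivity)] at ht
    linarith
  have htb : (t : ℂ) ∈ Metric.ball (0 : ℂ) (1 / s) := by
    rw [mem_ball_zero_iff, Complex.norm_real, Real.norm_eq_abs]
    refine ht.trans_lt (one_div_lt_one_div_of_lt hs (by linarith))
  have hsum := Complex.hasSum_taylorSeries_on_ball hf htb
  have hb := norm_sub_le_of_geometric_bound_of_hasSum (r := 2 * s * |t|) (C := M)
    (by linarith) (fun m => ?_) hsum n
  · have e : (f t).re - ∑ m ∈ Finset.range n,
        (((m.factorial : ℂ))⁻¹ * iteratedDeriv m f 0).re * t ^ m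
        = -((∑ m ∈ Finset.range n,
          ((m.factorial : ℂ))⁻¹ • ((t : ℂ) - 0) ^ m • iteratedDeriv m f 0) - f t).re := by
      rw [Complex.sub_re, Complex.re_sum, neg_sub]
      congr 1
      refine Finset.sum_congr rfl fun m _ => ?_
      rw [sub_zero, smul_eq_mul, smul_eq_mul, mul_left_comm, ← Complex.ofReal_pow,
        Complex.re_ofReal_mul, mul_comm]
    rw [e, abs_neg]
    refine (Complex.abs_re_le_norm _).trans (hb.trans ?_)
    rw [div_le_iff₀ (by linarith)]
    have := mul_nonneg hM0 (pow_nonneg (show 0 ≤ 2 * s * |t| by positivity) n)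
    nlinarith
  · rw [sub_zero, smul_eq_mul, smul_eq_mul, mul_left_comm, norm_mul, norm_pow, Complex.norm_real,
      Real.norm_eq_abs, mul_pow, ← mul_assoc, mul_comm]
    exact mul_le_mul_of_nonneg_right (hco m) (by positivity)

/-- The complex fixed point iteration, started at zero. -/
noncomputable def complexIterate {ι : Type*} [Fintype ι] (c : ℝ) (σ : ι → ℝ) (μ : ℝ) :
    ℕ → ℂ → ℂ
  | 0, _ => 0
  | j + 1, z => 1 / ((μ : ℂ) + c * ∑ i, (σ i : ℂ) / (1 + (z + complexIterate c σ μ j z) * σ i))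

section

variable {ι : Type*} [Fintype ι] {c : ℝ} {σ : ι → ℝ}

theorem re_one_add_ge {z w : ℂ} {x : ℝ} (hx : 0 ≤ x) (hw : 0 ≤ w.re) :
    1 - ‖z‖ * x ≤ (1 + (z + w) * x).re := by
  have h1 : -‖z‖ ≤ z.re := neg_le_of_abs_le (Complex.abs_re_le_norm z)
  have : (1 + (z + w) * (x : ℂ)).re = 1 + (z.re + w.re) * x := by simp
  rw [this]
  nlinarith [mul_nonneg hw hx, mul_le_mul_of_nonneg_right h1 hx]

theorem ne_zero_of_re_pos {z : ℂ} (h : 0 < z.re) : z ≠ 0 := by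
  rintro rfl
  simp at h

theorem re_div_nonneg {z : ℂ} {x : ℝ} (hx : 0 ≤ x) (h : 0 ≤ z.re) : 0 ≤ ((x : ℂ) / z).re := by
  rw [Complex.div_re]
  simp only [Complex.ofReal_re, Complex.ofReal_im, zero_mul, zero_div, add_zero]
  exact div_nonneg (mul_nonneg hx h) (Complex.normSq_nonneg z)

theorem norm_mul_lt_one {s x : ℝ} (hs : 0 < s) (hx : x ≤ s) {z : ℂ}
    (hz : z ∈ Metric.ball (0 : ℂ) (1 / s)) : ‖z‖ * x < 1 := by
  rw [mem_ball_zero_iff, lt_div_iff₀ hs] at hz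
  exact (mul_le_mul_of_nonneg_left hx (norm_nonneg z)).trans_lt hz

/-- The right half plane is invariant: if the iterate has nonnegative real part and `‖z‖ σ i < 1`,
then every `1 + (z + w) σ i` has positive real part, and so the next denominator has real part at
least `μ`. Working with iterates avoids having to solve the fixed point equation holomorphically. -/
theorem complexIterate_spec (hc : 0 ≤ c) {s μ : ℝ} (hs : 0 < s) (hμ : 0 < μ) (hσ : ∀ i, 0 ≤ σ i)
    (hσs : ∀ i, σ i ≤ s) (j : ℕ) :
    DifferentiableOn ℂ (complexIterate c σ μ j) (Metric.ball 0 (1 / s)) ∧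
      ∀ z ∈ Metric.ball (0 : ℂ) (1 / s), 0 ≤ (complexIterate c σ μ j z).re ∧
        ‖complexIterate c σ μ j z‖ ≤ 1 / μ := by
  induction j with
  | zero =>
    exact ⟨by simp [complexIterate], fun z _ => by
      simp [complexIterate, hμ.le]⟩
  | succ j ih =>
    have hpos : ∀ z ∈ Metric.ball (0 : ℂ) (1 / s), ∀ i,
        0 < (1 + (z + complexIterate c σ μ j z) * σ i).re := fun z hz i =>
      lt_of_lt_of_le (by linarith [norm_mul_lt_one hs (hσs i) hz])
        (re_one_add_ge (hσ i) (ih.2 z hz).1)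
    have hden : ∀ z ∈ Metric.ball (0 : ℂ) (1 / s),
        μ ≤ ((μ : ℂ) + c * ∑ i, (σ i : ℂ) / (1 + (z + complexIterate c σ μ j z) * σ i)).re := by
      intro z hz
      rw [Complex.add_re, Complex.ofReal_re, Complex.re_ofReal_mul, Complex.re_sum]
      have : 0 ≤ c * ∑ i, ((σ i : ℂ) / (1 + (z + complexIterate c σ μ j z) * σ i)).re :=
        mul_nonneg hc (Finset.sum_nonneg fun i _ => re_div_nonneg (hσ i) (hpos z hz i).le)
      linarith
    refine ⟨?_, fun z hz => ⟨?_, ?_⟩⟩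
    · show DifferentiableOn ℂ (fun z => 1 / ((μ : ℂ)
        + c * ∑ i, (σ i : ℂ) / (1 + (z + complexIterate c σ μ j z) * σ i))) _
      refine DifferentiableOn.div (differentiableOn_const _) ?_
        fun z hz => ne_zero_of_re_pos (hμ.trans_le (hden z hz))
      refine (differentiableOn_const _).add ((differentiableOn_const _).mul
        (DifferentiableOn.fun_sum fun i _ => ?_))
      refine DifferentiableOn.div (differentiableOn_const _) ?_
        fun z hz => ne_zero_of_re_pos (hpos z hz i)
      exact (differentiableOn_const _).add ((differentiableOn_id.add ih.1).mul
        (differentiableOn_const _))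
    · have := re_div_nonneg zero_le_one (hμ.le.trans (hden z hz))
      simpa [complexIterate] using this
    · show ‖1 / ((μ : ℂ) + c * ∑ i, (σ i : ℂ) / (1 + (z + complexIterate c σ μ j z) * σ i))‖ ≤ _
      rw [norm_div, norm_one]
      exact one_div_le_one_div_of_le hμ ((hden z hz).trans (Complex.re_le_norm _))

/-- The real fixed point iteration, started at zero. -/
noncomputable def realIterate (c : ℝ) (σ : ι → ℝ) (μ t : ℝ) : ℕ → ℝ
  | 0 => 0
  | j + 1 => 1 / (μ + stieltjesSum c σ (t + realIterate c σ μ t j))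

theorem complexIterate_ofReal (μ t : ℝ) (j : ℕ) :
    complexIterate c σ μ j (t : ℂ) = (realIterate c σ μ t j : ℂ) := by
  induction j with
  | zero => simp [complexIterate, realIterate]
  | succ j ih =>
    simp only [complexIterate, realIterate, stieltjesSum, ih]
    push_cast
    rfl

theorem realIterate_nonneg (hc : 0 ≤ c) (hσ : ∀ i, 0 ≤ σ i) {t μ : ℝ} (hμ : 0 < μ)
    (ht : ∀ i, 1 / 2 ≤ 1 + t * σ i) (j : ℕ) : 0 ≤ realIterate c σ μ t j := by
  induction j with
  | zero => exact le_rfl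
  | succ j ih =>
    exact one_div_nonneg.2 (add_nonneg hμ.le (stieltjesSum_nonneg hc hσ ht ih))

theorem tendsto_realIterate (hc : 0 ≤ c) (hσ : ∀ i, 0 ≤ σ i) {t μ w : ℝ} (hμ : 0 < μ)
    (ht : ∀ i, 1 / 2 ≤ 1 + t * σ i) (h : IsFixedInv c σ t μ w) :
    Tendsto (realIterate c σ μ t) atTop (𝓝 w) := by
  have hm : 0 ≤ stieltjesSum c σ t := by simpa using stieltjesSum_nonneg hc hσ ht le_rfl
  set q := 1 - μ / (μ + stieltjesSum c σ t)
  have hq0 : 0 ≤ q := sub_nonneg.2 (div_le_one_of_le₀ (by linarith) (by linarith))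
  have hq1 : q < 1 := sub_lt_self _ (div_pos hμ (by linarith))
  have hb : ∀ j, |realIterate c σ μ t j - w| ≤ q ^ j * |w| := by
    intro j
    induction j with
    | zero => simp [realIterate]
    | succ j ih =>
      refine (h.iterate_sub_le hc hσ hμ ht (realIterate_nonneg hc hσ hμ ht j)).trans ?_
      rw [pow_succ', mul_assoc]
      exact mul_le_mul_of_nonneg_left ih hq0
  refine tendsto_iff_dist_tendsto_zero.2 (squeeze_zero (fun _ => dist_nonneg) hb ?_)
  simpa using (tendsto_pow_atTop_nhds_zero_of_lt_one hq0 hq1).mul_const |w|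

/-- Taylor approximation of the deterministic quadratic form, relative to its value for an infinite
regularization. -/
theorem exists_taylor_fixedInv (hc : 0 ≤ c) {s μ : ℝ} (hs : 0 < s) (hμ : 0 < μ)
    (hσ : ∀ i, 0 ≤ σ i) (hσs : ∀ i, σ i ≤ s) {b : ι → ℝ} (hb : ∀ i, 0 ≤ b i) (n : ℕ) :
    ∃ a : Fin n → ℝ, ∀ t w : ℝ, |t| ≤ 1 / (4 * s) → IsFixedInv c σ t μ w →
      |∑ i, b i / (1 + (t + w) * σ i) - ∑ i, b i / (1 + t * σ i) - ∑ m : Fin n, a m * t ^ (m : ℕ)|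
        ≤ 2 * (4 * (∑ i, b i * σ i) / μ) * (2 * s * |t|) ^ n := by
  set M := 4 * (∑ i, b i * σ i) / μ with hM
  -- The second term is the value for an infinite regularization. The difference gains a factor `w σ
  -- i` in each summand, which is why it is bounded by `(∑ i, b i * σ i) / μ`; two denominators of
  -- norm at least `1 / 2` give the 4.
  let f : ℕ → ℂ → ℂ := fun j z => ∑ i, ((b i : ℂ) / (1 + (z + complexIterate c σ μ j z) * σ i)
    - (b i : ℂ) / (1 + (z + 0) * σ i))
  have hpos : ∀ j, ∀ z ∈ Metric.ball (0 : ℂ) (1 / s), ∀ i,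
      0 < (1 + (z + complexIterate c σ μ j z) * σ i).re := fun j z hz i =>
    lt_of_lt_of_le (by linarith [norm_mul_lt_one hs (hσs i) hz])
      (re_one_add_ge (hσ i) ((complexIterate_spec hc hs hμ hσ hσs j).2 z hz).1)
  have hf : ∀ j, DifferentiableOn ℂ (f j) (Metric.ball 0 (1 / s)) := by
    intro j
    refine DifferentiableOn.fun_sum fun i _ => DifferentiableOn.sub ?_ ?_
    · refine DifferentiableOn.div (differentiableOn_const _) ?_
        fun z hz => ne_zero_of_re_pos (hpos j z hz i)
      exact (differentiableOn_const _).add ((differentiableOn_id.add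
        (complexIterate_spec hc hs hμ hσ hσs j).1).mul (differentiableOn_const _))
    · refine DifferentiableOn.div (differentiableOn_const _) (by fun_prop)
        fun z hz => ne_zero_of_re_pos (hpos 0 z hz i)
  have hfM : ∀ j, ∀ z : ℂ, ‖z‖ ≤ 1 / (2 * s) → ‖f j z‖ ≤ M := by
    intro j z hz
    have hzb : z ∈ Metric.ball (0 : ℂ) (1 / s) := by
      rw [mem_ball_zero_iff]
      exact hz.trans_lt (one_div_lt_one_div_of_lt hs (by linarith))
    obtain ⟨hw0, hw1⟩ := (complexIterate_spec hc hs hμ hσ hσs j).2 z hzb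
    have hzs : ∀ i, ‖z‖ * σ i ≤ 1 / 2 := fun i => by
      have := mul_le_mul hz (hσs i) (hσ i) (by positivity)
      have e : 1 / (2 * s) * s = 1 / 2 := by field_simp
      linarith
    have e : M = ∑ i, b i * (1 / μ * σ i) * 4 := by
      rw [hM, Finset.mul_sum, Finset.sum_div]
      exact Finset.sum_congr rfl fun i _ => by ring
    rw [e]
    refine norm_sum_le_of_le _ fun i _ => ?_
    have h1 : 1 / 2 ≤ ‖1 + (z + complexIterate c σ μ j z) * σ i‖ :=
      le_trans (by linarith [hzs i]) ((re_one_add_ge (hσ i) hw0).trans (Complex.re_le_norm _))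
    have h2 : 1 / 2 ≤ ‖1 + (z + 0) * σ i‖ :=
      le_trans (by linarith [hzs i]) ((re_one_add_ge (hσ i) le_rfl).trans (Complex.re_le_norm _))
    have h1' := norm_pos_iff.1 (lt_of_lt_of_le (by norm_num) h1)
    have h2' := norm_pos_iff.1 (lt_of_lt_of_le (by norm_num) h2)
    rw [div_sub_div _ _ h1' h2', norm_div, norm_mul, div_le_iff₀ (by positivity)]
    have e2 : (b i : ℂ) * (1 + (z + 0) * σ i) - (1 + (z + complexIterate c σ μ j z) * σ i) * b i
        = -(b i * (complexIterate c σ μ j z * σ i)) := by ring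
    rw [e2, norm_neg, norm_mul, norm_mul, Complex.norm_real, Complex.norm_real, Real.norm_eq_abs,
      Real.norm_eq_abs, abs_of_nonneg (hb i), abs_of_nonneg (hσ i)]
    have h3 : 1 ≤ 4 * (‖1 + (z + complexIterate c σ μ j z) * σ i‖ * ‖1 + (z + 0) * σ i‖) := by
      nlinarith
    have h4 : b i * (‖complexIterate c σ μ j z‖ * σ i) ≤ b i * (1 / μ * σ i) :=
      mul_le_mul_of_nonneg_left (mul_le_mul_of_nonneg_right hw1 (hσ i)) (hb i)
    have h5 : 0 ≤ b i * (1 / μ * σ i) := mul_nonneg (hb i) (mul_nonneg (by positivity) (hσ i))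
    rw [mul_assoc]
    nlinarith
  choose a ha hat using fun j => exists_real_taylor_of_bounded hs (hf j) (hfM j)
  -- The coefficients depend on the iteration step but stay in a fixed compact box. Along a
  -- convergent subsequence the Taylor bound passes to the limit for all `t` at once.
  obtain ⟨a', -, φ, hφ, hlim⟩ := (isCompact_univ_pi fun m : Fin n =>
      isCompact_Icc (a := -(M * (2 * s) ^ (m : ℕ))) (b := M * (2 * s) ^ (m : ℕ))).tendsto_subseq
    (x := fun j (m : Fin n) => a j m) (fun j m _ => abs_le.1 (ha j m))
  refine ⟨a', fun t w ht h => ?_⟩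
  have hts : ∀ i, 1 / 2 ≤ 1 + t * σ i := fun i => by
    have := mul_le_mul ht (hσs i) (hσ i) (by positivity)
    have e : 1 / (4 * s) * s = 1 / 4 := by field_simp
    have h3 := neg_abs_le (t * σ i)
    rw [abs_mul, abs_of_nonneg (hσ i)] at h3
    linarith
  have hw := (tendsto_realIterate hc hσ hμ hts h).comp hφ.tendsto_atTop
  have hre : ∀ j, (f j t).re = ∑ i, b i / (1 + (t + realIterate c σ μ t j) * σ i)
      - ∑ i, b i / (1 + t * σ i) := by
    intro j
    rw [← Finset.sum_sub_distrib, ← Complex.ofReal_re (∑ i, _)]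
    congr 1
    simp only [f, complexIterate_ofReal]
    push_cast
    simp
  have hbd : ∀ j, |∑ i, b i / (1 + (t + realIterate c σ μ t (φ j)) * σ i)
      - ∑ i, b i / (1 + t * σ i) - ∑ m : Fin n, a (φ j) m * t ^ (m : ℕ)|
        ≤ 2 * M * (2 * s * |t|) ^ n := fun j => by
    have := hat (φ j) n t ht
    rwa [hre, Finset.sum_range] at this
  refine le_of_tendsto' (x := atTop) (Tendsto.abs ((Tendsto.sub_const ?_ _).sub ?_)) hbd
  · refine tendsto_finsetSum _ fun i _ => Tendsto.div tendsto_const_nhds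
      (((hw.const_add t).mul_const _).const_add 1) (one_add_pos (hσ i) (hts i) h.1.le).ne'
  · exact tendsto_finsetSum _ fun m _ => ((tendsto_pi_nhds.1 hlim m).mul_const _)

end

/-! ### Resolvent expansions -/

section Ring

variable {A : Type*} [Ring A] {M₀ K S U R : A}

/-- Repeated use of `M₀ = 1 - M₀ K` strips the factors `M₀`. Applied to `β` with `K = Yᵀ Y`, every
correction meets `β` only through `Y S ^ j U β`. -/
theorem resolvent_pow_right (hM : M₀ * (1 + K) = 1) (hRU : R = U - R * K * U) (l : ℕ) :
    (M₀ * S) ^ l * R = S ^ l * U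
      - ∑ i ∈ Finset.range l, (M₀ * S) ^ i * M₀ * K * S ^ (l - i) * U
      - (M₀ * S) ^ l * R * K * U := by
  have key : ∀ l : ℕ, (M₀ * S) ^ l * U = S ^ l * U
      - ∑ i ∈ Finset.range l, (M₀ * S) ^ i * M₀ * K * S ^ (l - i) * U := by
    intro l
    induction l with
    | zero => simp
    | succ l ih =>
      have h0 : M₀ = 1 - M₀ * K := by rw [eq_sub_iff_add_eq, ← mul_one_add, hM]
      have h1 : M₀ * S * S ^ l * U = S ^ (l + 1) * U - M₀ * K * S ^ (l + 1) * U := by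
        rw [mul_assoc M₀, ← pow_succ']
        nth_rewrite 1 [h0]
        noncomm_ring
      rw [pow_succ', mul_assoc, ih, mul_sub, Finset.sum_range_succ', ← mul_assoc (M₀ * S), h1,
        Finset.mul_sum, pow_zero, one_mul, Nat.sub_zero, ← sub_sub, sub_right_comm]
      congr 2
      refine Finset.sum_congr rfl fun i _ => ?_
      rw [pow_succ' _ i, Nat.succ_sub_succ]
      simp only [mul_assoc]
  nth_rewrite 1 [hRU]
  rw [mul_sub, key]
  simp only [mul_assoc]

/-- The mirror image, with `M₀ = 1 - K M₀`: the factor `K` splits each correction into an inner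
product of two images under `Y`. -/
theorem resolvent_pow_left (hM : (1 + K) * M₀ = 1) (hRU : R = U - U * K * R) (n : ℕ) :
    (M₀ * S) ^ n * R = S ^ n * U
      - ∑ j ∈ Finset.range n, S ^ j * K * ((M₀ * S) ^ (n - j) * R) - S ^ n * U * K * R := by
  have key : ∀ n : ℕ, (M₀ * S) ^ n * R = S ^ n * R
      - ∑ j ∈ Finset.range n, S ^ j * K * ((M₀ * S) ^ (n - j) * R) := by
    intro n
    induction n with
    | zero => simp
    | succ n ih =>
      have h0 : M₀ = 1 - K * M₀ := by rw [eq_sub_iff_add_eq, ← one_add_mul, hM]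
      have h1 : (M₀ * S) ^ (n + 1) * R
          = S * ((M₀ * S) ^ n * R) - K * ((M₀ * S) ^ (n + 1) * R) := by
        rw [pow_succ']
        nth_rewrite 1 [h0]
        noncomm_ring
      rw [h1, ih, mul_sub, Finset.sum_range_succ', Finset.mul_sum, pow_zero, one_mul, Nat.sub_zero,
        ← sub_sub, ← mul_assoc, ← pow_succ']
      congr 2
      refine Finset.sum_congr rfl fun i _ => ?_
      rw [pow_succ' _ i, Nat.succ_sub_succ]
      simp only [mul_assoc]
  rw [key]
  nth_rewrite 1 [hRU]
  rw [mul_sub]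
  simp only [mul_assoc]
  abel

/-- Finite Neumann series with its exact remainder. -/
theorem resolvent_taylor [Algebra ℝ A] {t : ℝ} (hR : R = M₀ - t • (M₀ * S * R)) (n : ℕ) :
    R = ∑ m ∈ Finset.range n, (-t) ^ m • ((M₀ * S) ^ m * M₀) + (-t) ^ n • ((M₀ * S) ^ n * R) := by
  induction n with
  | zero => simp
  | succ n ih =>
    have h1 : (-t) ^ n • ((M₀ * S) ^ n * R) = (-t) ^ n • ((M₀ * S) ^ n * M₀)
        + (-t) ^ (n + 1) • ((M₀ * S) ^ (n + 1) * R) := by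
      nth_rewrite 1 [hR]
      rw [mul_sub, mul_smul_comm, smul_sub, smul_smul, pow_succ (-t), pow_succ (M₀ * S),
        mul_assoc _ (M₀ * S) R, mul_neg, neg_smul, ← sub_eq_add_neg]
    rw [Finset.sum_range_succ, add_assoc, ← h1]
    exact ih

end Ring

/-! ### Operator bounds for the resolvents. -/

section Hilbert

variable {E F : Type*} [NormedAddCommGroup E] [InnerProductSpace ℝ E]
  [NormedAddCommGroup F] [InnerProductSpace ℝ F]

theorem norm_mul_pow_apply_le {M₀ S : E →L[ℝ] E} {s : ℝ} (hs : 0 ≤ s) (hM : ∀ x, ‖M₀ x‖ ≤ ‖x‖)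
    (hS : ∀ x, ‖S x‖ ≤ s * ‖x‖) (i : ℕ) (x : E) : ‖((M₀ * S) ^ i) x‖ ≤ s ^ i * ‖x‖ := by
  induction i with
  | zero => simp
  | succ i ih =>
    rw [pow_succ', mul_apply_eq_comp, mul_apply_eq_comp, pow_succ',
      mul_assoc]
    exact (hM _).trans ((hS _).trans (mul_le_mul_of_nonneg_left ih hs))

theorem norm_comp_pow_apply_le {M₀ S : E →L[ℝ] E} (Y : E →L[ℝ] F) {s : ℝ} (hs : 0 ≤ s)
    (hM : ∀ x, ‖M₀ x‖ ≤ ‖x‖) (hY : ∀ x, ‖Y (M₀ x)‖ ≤ ‖x‖)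
    (hS : ∀ x, ‖S x‖ ≤ s * ‖x‖) (i : ℕ) (x : E) (r : ℝ) (hx : ‖x‖ ≤ r) (hYx : ‖Y x‖ ≤ r) :
    ‖Y (((M₀ * S) ^ i) x)‖ ≤ s ^ i * r := by
  cases i with
  | zero => simpa using hYx
  | succ i =>
    rw [pow_succ', mul_apply_eq_comp, mul_apply_eq_comp, pow_succ',
      mul_assoc]
    refine (hY _).trans ((hS _).trans (mul_le_mul_of_nonneg_left ?_ hs))
    exact (norm_mul_pow_apply_le hs hM hS i x).trans (mul_le_mul_of_nonneg_left hx (pow_nonneg hs i))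

variable [CompleteSpace E] [CompleteSpace F]

/-- With `u = T Yᵀ x`, coercivity gives `‖u‖² / 2 + ‖Y u‖² ≤ ⟪Y u, x⟫ ≤ ‖Y u‖ ‖x‖`, and both bounds
follow. Only half of `‖u‖²` is required, which leaves room for the perturbation `t S` with `|t| s ≤
1 / 2`. -/
theorem norm_resolvent_adjoint_le (Y : E →L[ℝ] F) (Q T : E →L[ℝ] E) (hQT : Q * T = 1)
    (hQ : ∀ u, 1 / 2 * ‖u‖ ^ 2 + ‖Y u‖ ^ 2 ≤ inner ℝ u (Q u)) (x : F) :
    ‖Y (T (Y.adjoint x))‖ ≤ ‖x‖ ∧ ‖T (Y.adjoint x)‖ ≤ ‖x‖ := by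
  set u := T (Y.adjoint x) with hu
  have h1 : Q u = Y.adjoint x := by
    rw [hu, ← mul_apply_eq_comp, hQT, one_apply_eq_self]
  have h2 := hQ u
  rw [h1, ContinuousLinearMap.adjoint_inner_right] at h2
  have h3 := real_inner_le_norm (Y u) x
  constructor
  · by_contra! h
    nlinarith [norm_nonneg (Y u), norm_nonneg x, sq_nonneg ‖u‖]
  · refine (sq_le_sq₀ (norm_nonneg _) (norm_nonneg x)).1 ?_
    nlinarith [sq_nonneg (‖Y u‖ - ‖x‖ / 2), sq_nonneg ‖x‖]

theorem norm_resolvent_le (Y : E →L[ℝ] F) (T : E →L[ℝ] E)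
    (hT : (1 + Y.adjoint.comp Y) * T = 1) (x : E) : ‖T x‖ ≤ ‖x‖ ∧ ‖Y (T x)‖ ≤ ‖x‖ := by
  set u := T x with hu
  have h1 : u + Y.adjoint (Y u) = x := by
    have := congrArg (fun L : E →L[ℝ] E => L x) hT
    simpa [hu] using this
  have h2 : ‖u‖ ^ 2 + ‖Y u‖ ^ 2 = inner ℝ u x := by
    rw [← h1, inner_add_right, ContinuousLinearMap.adjoint_inner_right,
      real_inner_self_eq_norm_sq, real_inner_self_eq_norm_sq]
  have h3 := real_inner_le_norm u x
  constructor
  · by_contra! h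
    nlinarith [norm_nonneg u, norm_nonneg x, sq_nonneg ‖Y u‖]
  · by_contra! h
    nlinarith [norm_nonneg x, sq_nonneg (‖u‖ - ‖x‖ / 2), sq_nonneg ‖x‖]

/-- Taylor approximation of the difference of the quadratic forms of the two resolvents
`(1 + t S + Yᵀ Y)⁻¹` and `(1 + t S)⁻¹`. -/
theorem abs_resolvent_sub_taylor_le (Y : E →L[ℝ] F) (S M₀ U R : E →L[ℝ] E) (β : E) {s t W : ℝ}
    (hs : 0 ≤ s) (hW : 0 ≤ W) (hSs : ∀ x, ‖S x‖ ≤ s * ‖x‖) (hts : |t| * s ≤ 1 / 2)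
    (hS : ∀ x y, inner ℝ (S x) y = inner ℝ x (S y))
    (hUsymm : ∀ x y, inner ℝ (U x) y = inner ℝ x (U y)) (hSU : Commute S U)
    (hM₁ : M₀ * (1 + Y.adjoint.comp Y) = 1) (hM₂ : (1 + Y.adjoint.comp Y) * M₀ = 1)
    (hU₁ : U * (1 + t • S) = 1) (hU₂ : (1 + t • S) * U = 1)
    (hR₁ : R * (1 + t • S + Y.adjoint.comp Y) = 1) (hR₂ : (1 + t • S + Y.adjoint.comp Y) * R = 1)
    (n : ℕ) (h₁ : ∀ j ≤ n, ‖Y ((S ^ j) β)‖ ≤ W * s ^ j)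
    (h₂ : ∀ j ≤ n, ‖Y ((S ^ j * U) β)‖ ≤ W * s ^ j) :
    |inner ℝ β (R β) - inner ℝ β (U β) - ∑ m ∈ Finset.range n,
        (-1) ^ m * (inner ℝ β (((M₀ * S) ^ m * M₀) β) - inner ℝ β ((S ^ m) β)) * t ^ m|
      ≤ (n + 1) * (n + 2) * W ^ 2 * (s * |t|) ^ n := by
  set K : E →L[ℝ] E := Y.adjoint.comp Y with hK
  have eRU : R = U - U * K * R := by
    have : U * (1 + t • S + K) * R = U := by rw [mul_assoc, hR₂, mul_one]
    rw [mul_add, hU₁, add_mul, one_mul] at this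
    exact eq_sub_of_add_eq this
  have eRU' : R = U - R * K * U := by
    have : R * ((1 + t • S + K) * U) = U := by rw [← mul_assoc, hR₁, one_mul]
    rw [add_mul, hU₂, mul_add, mul_one, ← mul_assoc] at this
    exact eq_sub_of_add_eq this
  have eRM : R = M₀ - t • (M₀ * S * R) := by
    have : M₀ * (1 + t • S + K) * R = M₀ := by rw [mul_assoc, hR₂, mul_one]
    rw [add_right_comm, mul_add, hM₁, add_mul, one_mul, mul_smul_comm, smul_mul_assoc] at this
    exact eq_sub_of_add_eq this
  -- The same Taylor expansion with `M₀` replaced by 1; it produces the terms `S ^ m` that are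
  -- subtracted from the coefficients.
  have eU1 : U = 1 - t • (1 * S * U) := by
    rw [add_mul, one_mul, smul_mul_assoc] at hU₂
    rw [one_mul]
    exact eq_sub_of_add_eq hU₂
  have bM : ∀ x, ‖M₀ x‖ ≤ ‖x‖ := fun x => (norm_resolvent_le Y M₀ hM₂ x).1
  have bYM : ∀ x, ‖Y (M₀ x)‖ ≤ ‖x‖ := fun x => (norm_resolvent_le Y M₀ hM₂ x).2
  have hKu : ∀ u, inner ℝ u (K u) = ‖Y u‖ ^ 2 := fun u => by
    rw [hK, ContinuousLinearMap.comp_apply, ContinuousLinearMap.adjoint_inner_right,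
      real_inner_self_eq_norm_sq]
  have bMY := norm_resolvent_adjoint_le Y (1 + K) M₀ hM₂ (fun u => by
    rw [_root_.add_apply, inner_add_right, hKu, one_apply_eq_self,
      real_inner_self_eq_norm_sq]
    nlinarith [sq_nonneg ‖u‖])
  have bRY := norm_resolvent_adjoint_le Y (1 + t • S + K) R hR₂ (fun u => by
    rw [_root_.add_apply, _root_.add_apply, inner_add_right,
      inner_add_right, hKu, one_apply_eq_self, real_inner_self_eq_norm_sq,
      _root_.smul_apply, inner_smul_right]
    have h1 : |t * inner ℝ u (S u)| ≤ |t| * s * ‖u‖ ^ 2 := by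
      rw [abs_mul, mul_assoc]
      refine mul_le_mul_of_nonneg_left ?_ (abs_nonneg t)
      refine (abs_real_inner_le_norm u (S u)).trans ?_
      nlinarith [mul_le_mul_of_nonneg_left (hSs u) (norm_nonneg u)]
    nlinarith [neg_abs_le (t * inner ℝ u (S u)), mul_le_mul_of_nonneg_right hts (sq_nonneg ‖u‖)])
  have hsp : ∀ l : ℕ, 0 ≤ W * s ^ l := fun l => mul_nonneg hW (pow_nonneg hs l)
  -- the vectors `Y (M₀ S) ^ l R β`
  have hvec : ∀ l ≤ n, ‖Y (((M₀ * S) ^ l * R) β)‖ ≤ (l + 2) * (W * s ^ l) := by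
    intro l hl
    rw [resolvent_pow_right hM₁ eRU' l, _root_.sub_apply,
      _root_.sub_apply, map_sub, map_sub, _root_.sum_apply, map_sum]
    have a1 := h₂ l hl
    have a2 : ‖∑ i ∈ Finset.range l, Y (((M₀ * S) ^ i * M₀ * K * S ^ (l - i) * U) β)‖
        ≤ l * (W * s ^ l) := by
      have : ∀ i ∈ Finset.range l,
          ‖Y (((M₀ * S) ^ i * M₀ * K * S ^ (l - i) * U) β)‖ ≤ W * s ^ l := by
        intro i hi
        have e : ((M₀ * S) ^ i * M₀ * K * S ^ (l - i) * U) β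
            = ((M₀ * S) ^ i) (M₀ (Y.adjoint (Y ((S ^ (l - i) * U) β)))) := by
          simp [hK]
        rw [e]
        obtain ⟨c1, c2⟩ := bMY (Y ((S ^ (l - i) * U) β))
        refine (norm_comp_pow_apply_le Y hs bM bYM hSs i _ _ c2 c1).trans ?_
        refine (mul_le_mul_of_nonneg_left (h₂ (l - i) (by omega)) (pow_nonneg hs i)).trans_eq ?_
        rw [mul_left_comm, ← pow_add, Nat.add_sub_cancel' (Finset.mem_range.1 hi).le]
      refine (norm_sum_le_of_le _ this).trans_eq ?_
      rw [Finset.sum_const, Finset.card_range, nsmul_eq_mul]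
    have a3 : ‖Y (((M₀ * S) ^ l * R * K * U) β)‖ ≤ W * s ^ l := by
      have e : ((M₀ * S) ^ l * R * K * U) β = ((M₀ * S) ^ l) (R (Y.adjoint (Y (U β)))) := by
        simp [hK]
      rw [e]
      obtain ⟨c1, c2⟩ := bRY (Y (U β))
      refine (norm_comp_pow_apply_le Y hs bM bYM hSs l _ _ c2 c1).trans ?_
      have := h₂ 0 (Nat.zero_le n)
      rw [pow_zero, one_mul, pow_zero, mul_one] at this
      rw [mul_comm W]
      exact mul_le_mul_of_nonneg_left this (pow_nonneg hs l)
    have := (norm_sub_le_of_le (norm_sub_le_of_le a1 a2) a3)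
    linarith
  have hSpow : ∀ (j : ℕ) (x y : E), inner ℝ ((S ^ j) x) y = inner ℝ x ((S ^ j) y) := by
    intro j
    induction j with
    | zero => simp
    | succ j ih =>
      intro x y
      rw [pow_succ, mul_apply_eq_comp, ih, hS, ← mul_apply_eq_comp,
        ← pow_succ', pow_succ, mul_apply_eq_comp]
  -- the remainder
  have hrem : |inner ℝ β (((M₀ * S) ^ n * R) β) - inner ℝ β ((S ^ n * U) β)|
      ≤ (n + 1) * (n + 2) * W ^ 2 * s ^ n := by
    have e : inner ℝ β (((M₀ * S) ^ n * R) β) - inner ℝ β ((S ^ n * U) β)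
        = -(∑ j ∈ Finset.range n, inner ℝ (Y ((S ^ j) β)) (Y (((M₀ * S) ^ (n - j) * R) β))
          + inner ℝ (Y ((S ^ n * U) β)) (Y (R β))) := by
      rw [← inner_sub_right, ← _root_.sub_apply, resolvent_pow_left hM₂ eRU n,
        show ∀ a b d : E →L[ℝ] E, a - b - d - a = -(b + d) from fun a b d => by abel, _root_.neg_apply, inner_neg_right,
        _root_.add_apply, inner_add_right, _root_.sum_apply, inner_sum]
      congr 2
      · refine Finset.sum_congr rfl fun j _ => ?_
        rw [mul_assoc, mul_apply_eq_comp, ← hSpow, mul_apply_eq_comp, hK,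
          ContinuousLinearMap.comp_apply, ContinuousLinearMap.adjoint_inner_right]
      · rw [mul_assoc (S ^ n * U), mul_apply_eq_comp, mul_apply_eq_comp,
          ← hSpow, ← hUsymm, mul_apply_eq_comp K, hK,
          ContinuousLinearMap.comp_apply, ContinuousLinearMap.adjoint_inner_right,
          ← mul_apply_eq_comp U, ← (hSU.pow_left n).eq]
    rw [e, abs_neg]
    have b1 : |∑ j ∈ Finset.range n, inner ℝ (Y ((S ^ j) β)) (Y (((M₀ * S) ^ (n - j) * R) β))|
        ≤ n * ((n + 2) * (W ^ 2 * s ^ n)) := by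
      have : ∀ j ∈ Finset.range n,
          ‖inner ℝ (Y ((S ^ j) β)) (Y (((M₀ * S) ^ (n - j) * R) β))‖
            ≤ (n + 2) * (W ^ 2 * s ^ n) := by
        intro j hj
        have hjn := (Finset.mem_range.1 hj).le
        refine (norm_inner_le_norm _ _).trans ?_
        refine (mul_le_mul (h₁ j hjn) (hvec (n - j) (Nat.sub_le n j)) (norm_nonneg _)
          (hsp j)).trans ?_
        have e2 : W * s ^ j * ((((n - j : ℕ) : ℝ) + 2) * (W * s ^ (n - j)))
            = (((n - j : ℕ) : ℝ) + 2) * (W ^ 2 * (s ^ j * s ^ (n - j))) := by ring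
        rw [e2, ← pow_add, Nat.add_sub_cancel' hjn]
        refine mul_le_mul_of_nonneg_right ?_ (mul_nonneg (sq_nonneg W) (pow_nonneg hs n))
        have : ((n - j : ℕ) : ℝ) ≤ n := by exact_mod_cast Nat.sub_le n j
        linarith
      refine (norm_sum_le_of_le _ this).trans_eq ?_
      rw [Finset.sum_const, Finset.card_range, nsmul_eq_mul]
    have b2 : |inner ℝ (Y ((S ^ n * U) β)) (Y (R β))| ≤ 2 * (W ^ 2 * s ^ n) := by
      refine (abs_real_inner_le_norm _ _).trans ?_
      have := hvec 0 (Nat.zero_le n)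
      rw [pow_zero, one_mul, pow_zero, mul_one, Nat.cast_zero, zero_add] at this
      refine (mul_le_mul (h₂ n le_rfl) this (norm_nonneg _) (hsp n)).trans_eq ?_
      ring
    refine (abs_add_le _ _).trans ((add_le_add b1 b2).trans ?_)
    -- The two bounds add up to `n (n + 2) + 2`, which is at most `(n + 1) (n + 2)`.
    have : 0 ≤ (n : ℝ) * (W ^ 2 * s ^ n) :=
      mul_nonneg n.cast_nonneg (mul_nonneg (sq_nonneg W) (pow_nonneg hs n))
    nlinarith
  have eR := congrArg (fun L : E →L[ℝ] E => inner ℝ β (L β)) (resolvent_taylor eRM n)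
  have eU := congrArg (fun L : E →L[ℝ] E => inner ℝ β (L β)) (resolvent_taylor eU1 n)
  simp only [_root_.add_apply, _root_.sum_apply, inner_add_right,
    inner_sum, _root_.smul_apply, inner_smul_right, one_mul, mul_one] at eR eU
  have e : inner ℝ β (R β) - inner ℝ β (U β) - ∑ m ∈ Finset.range n,
        (-1) ^ m * (inner ℝ β (((M₀ * S) ^ m * M₀) β) - inner ℝ β ((S ^ m) β)) * t ^ m
      = (-t) ^ n * (inner ℝ β (((M₀ * S) ^ n * R) β) - inner ℝ β ((S ^ n * U) β)) := by
    have e3 : ∑ m ∈ Finset.range n,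
        (-1) ^ m * (inner ℝ β (((M₀ * S) ^ m * M₀) β) - inner ℝ β ((S ^ m) β)) * t ^ m
        = ∑ m ∈ Finset.range n, (-t) ^ m * inner ℝ β (((M₀ * S) ^ m * M₀) β)
          - ∑ m ∈ Finset.range n, (-t) ^ m * inner ℝ β ((S ^ m) β) := by
      rw [← Finset.sum_sub_distrib]
      refine Finset.sum_congr rfl fun m _ => ?_
      rw [neg_pow t m]
      ring
    rw [e3, eR, eU]
    ring
  rw [e, abs_mul, abs_pow, abs_neg, mul_pow, mul_comm, ← mul_assoc]
  exact mul_le_mul_of_nonneg_right hrem (by positivity)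

end Hilbert

/-! ### Functional calculus of a symmetric matrix -/

section FunctionalCalculus

variable {n : Type*} [Fintype n] [DecidableEq n] {A : Matrix n n ℝ} (hA : A.IsHermitian)

theorem cfc_mul_cfc (f g : ℝ → ℝ) : hA.cfc f * hA.cfc g = hA.cfc fun s => f s * g s := by
  unfold Matrix.IsHermitian.cfc
  rw [← map_mul, diagonal_mul_diagonal]
  rfl

theorem cfc_add_cfc (f g : ℝ → ℝ) : hA.cfc f + hA.cfc g = hA.cfc fun s => f s + g s := by
  unfold Matrix.IsHermitian.cfc
  rw [← map_add, diagonal_add]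
  rfl

theorem smul_cfc (r : ℝ) (f : ℝ → ℝ) : r • hA.cfc f = hA.cfc fun s => r * f s := by
  unfold Matrix.IsHermitian.cfc
  rw [← map_smul, ← diagonal_smul]
  rfl

theorem cfc_eq_self : (hA.cfc fun s => s) = A := hA.spectral_theorem.symm

theorem cfc_one : (hA.cfc fun _ => 1) = 1 := by
  have : (diagonal (RCLike.ofReal ∘ (fun _ : ℝ => (1 : ℝ)) ∘ hA.eigenvalues) : Matrix n n ℝ) = 1 :=
    diagonal_one
  unfold Matrix.IsHermitian.cfc
  rw [this, map_one]

theorem cfc_congr {f g : ℝ → ℝ} (h : ∀ i, f (hA.eigenvalues i) = g (hA.eigenvalues i)) :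
    hA.cfc f = hA.cfc g := by
  unfold Matrix.IsHermitian.cfc
  congr 2
  funext i
  simp [h i]

theorem transpose_cfc (f : ℝ → ℝ) : (hA.cfc f)ᵀ = hA.cfc f := by
  rw [← conjTranspose_eq_transpose_of_trivial, ← star_eq_conjTranspose]
  unfold Matrix.IsHermitian.cfc
  rw [← map_star, star_eq_conjTranspose, diagonal_conjTranspose, star_trivial]

theorem pow_mul_cfc (f : ℝ → ℝ) (j : ℕ) : A ^ j * hA.cfc f = hA.cfc fun s => s ^ j * f s := by
  induction j with
  | zero => simp
  | succ j ih =>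
    rw [pow_succ', mul_assoc, ih]
    nth_rewrite 1 [← cfc_eq_self hA]
    rw [cfc_mul_cfc]
    simp only [pow_succ', mul_assoc]

theorem one_add_smul_eq_cfc (r : ℝ) : 1 + r • A = hA.cfc fun s => 1 + r * s := by
  rw [← cfc_add_cfc hA (fun _ => 1) (fun s => r * s), cfc_one, ← smul_cfc, cfc_eq_self]

theorem one_add_smul_mul_cfc {r : ℝ} (h : ∀ i, 0 < 1 + r * hA.eigenvalues i) :
    (1 + r • A) * (hA.cfc fun s => 1 / (1 + r * s)) = 1 := by
  rw [one_add_smul_eq_cfc hA, cfc_mul_cfc, ← cfc_one hA]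
  exact cfc_congr hA fun i => mul_one_div_cancel (h i).ne'

theorem inv_one_add_smul {r : ℝ} (h : ∀ i, 0 < 1 + r * hA.eigenvalues i) :
    (1 + r • A)⁻¹ = hA.cfc fun s => 1 / (1 + r * s) :=
  Matrix.inv_eq_right_inv (one_add_smul_mul_cfc hA h)

theorem dotProduct_cfc_mulVec (f : ℝ → ℝ) (u v : n → ℝ) :
    u ⬝ᵥ (hA.cfc f *ᵥ v) = ∑ i, f (hA.eigenvalues i)
      * ((u ⬝ᵥ fun j => hA.eigenvectorBasis i j) * (v ⬝ᵥ fun j => hA.eigenvectorBasis i j)) := by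
  have h : ∀ w : n → ℝ, w ᵥ* (hA.eigenvectorUnitary : Matrix n n ℝ)
      = fun i => w ⬝ᵥ fun j => hA.eigenvectorBasis i j := by
    intro w
    funext i
    simp [vecMul, IsHermitian.eigenvectorUnitary_apply, dotProduct]
  unfold Matrix.IsHermitian.cfc
  rw [Unitary.conjStarAlgAut_apply, star_eq_conjTranspose, conjTranspose_eq_transpose_of_trivial,
    ← mulVec_mulVec, ← mulVec_mulVec, dotProduct_mulVec, mulVec_transpose, h, h]
  simp only [dotProduct, mulVec_diagonal]
  refine Finset.sum_congr rfl fun i _ => ?_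
  simp only [Function.comp_apply, RCLike.ofReal_real_eq_id, id_eq]
  ring

/-- The ordering of the eigenvalues of `B` need not match that of `A`. Only the multisets agree, as
roots of the characteristic polynomial. -/
theorem sum_eigenvalues_cfc {B : Matrix n n ℝ} (hB : B.IsHermitian) {f : ℝ → ℝ}
    (h : B = hA.cfc f) (g : ℝ → ℝ) :
    ∑ i, g (hB.eigenvalues i) = ∑ i, g (f (hA.eigenvalues i)) := by
  have h1 : B.charpoly = ∏ i, (Polynomial.X - Polynomial.C (f (hA.eigenvalues i))) := by
    rw [h]
    unfold Matrix.IsHermitian.cfc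
    rw [Unitary.conjStarAlgAut_apply, charpoly_mul_comm, ← mul_assoc, Unitary.coe_star_mul_self,
      one_mul, charpoly_diagonal]
    rfl
  have h2 := hB.roots_charpoly_eq_eigenvalues
  rw [h1, Polynomial.roots_prod _ _ (Finset.prod_ne_zero_iff.2 fun i _ =>
    Polynomial.X_sub_C_ne_zero _)] at h2
  simp only [Polynomial.roots_X_sub_C, Multiset.bind_singleton] at h2
  have h3 := congrArg (fun m => (m.map g).sum) h2
  simp only [Multiset.map_map] at h3
  exact h3.symm

end FunctionalCalculus

/-! ### Second moments -/

section SecondMoment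

variable {P : ℕ} {D : Measure (Fin P → ℝ)}

theorem integrable_coord_mul (hD : MemLp (fun x : Fin P → ℝ => x) 2 D) (i j : Fin P) :
    Integrable (fun x => x i * x j) D :=
  (hD.eval i).integrable_mul (hD.eval j)

theorem dotProduct_mul_eq_sum (u v x : Fin P → ℝ) :
    (u ⬝ᵥ x) * (v ⬝ᵥ x) = ∑ i, ∑ j, u i * v j * (x i * x j) := by
  simp only [dotProduct, Finset.sum_mul_sum]
  exact Finset.sum_congr rfl fun i _ => Finset.sum_congr rfl fun j _ => by ring

theorem integrable_dotProduct_mul (hD : MemLp (fun x : Fin P → ℝ => x) 2 D) (u v : Fin P → ℝ) :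
    Integrable (fun x => (u ⬝ᵥ x) * (v ⬝ᵥ x)) D := by
  simp only [dotProduct_mul_eq_sum]
  exact integrable_finsetSum _ fun i _ => integrable_finsetSum _ fun j _ =>
    (integrable_coord_mul hD i j).const_mul _

theorem integral_dotProduct_mul (hD : MemLp (fun x : Fin P → ℝ => x) 2 D) (u v : Fin P → ℝ) :
    ∫ x, (u ⬝ᵥ x) * (v ⬝ᵥ x) ∂D = u ⬝ᵥ (secondMoment D *ᵥ v) := by
  simp only [dotProduct_mul_eq_sum]
  rw [integral_finsetSum _ fun i _ => integrable_finsetSum _ fun j _ =>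
    (integrable_coord_mul hD i j).const_mul _]
  simp only [dotProduct, mulVec, Finset.mul_sum]
  refine Finset.sum_congr rfl fun i _ => ?_
  rw [integral_finsetSum _ fun j _ => (integrable_coord_mul hD i j).const_mul _]
  refine Finset.sum_congr rfl fun j _ => ?_
  rw [integral_const_mul, secondMoment, of_apply]
  ring

theorem dotProduct_secondMoment_nonneg (hD : MemLp (fun x : Fin P → ℝ => x) 2 D)
    (u : Fin P → ℝ) : 0 ≤ u ⬝ᵥ (secondMoment D *ᵥ u) := by
  rw [← integral_dotProduct_mul hD]
  exact integral_nonneg fun x => mul_self_nonneg _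

theorem risk_eq (hD : MemLp (fun x : Fin P → ℝ => x) 2 D) (β b : Fin P → ℝ) :
    risk D β b = (β - b) ⬝ᵥ (secondMoment D *ᵥ (β - b)) := by
  rw [← integral_dotProduct_mul hD]
  simp only [risk, sub_dotProduct, sq]

theorem popEigenvalue_nonneg (hD : MemLp (fun x : Fin P → ℝ => x) 2 D) (i : Fin P) :
    0 ≤ popEigenvalue D i := by
  have h : (secondMoment D).PosSemidef :=
    Matrix.PosSemidef.of_dotProduct_mulVec_nonneg (secondMoment_isHermitian D) fun u => by
      rw [star_trivial]
      exact dotProduct_secondMoment_nonneg hD u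
  exact h.eigenvalues_nonneg i

theorem popEigenvalue_le_opNorm (hD : MemLp (fun x : Fin P → ℝ => x) 2 D) (i : Fin P) :
    popEigenvalue D i ≤ opNorm (secondMoment D) := by
  have h := (secondMoment_isHermitian D).mulVec_eigenvectorBasis i
  have h1 := ContinuousLinearMap.le_opNorm
    (Matrix.toEuclideanCLM (n := Fin P) (𝕜 := ℝ) (secondMoment D))
    ((secondMoment_isHermitian D).eigenvectorBasis i)
  have h2 : (Matrix.toEuclideanCLM (n := Fin P) (𝕜 := ℝ) (secondMoment D))
      ((secondMoment_isHermitian D).eigenvectorBasis i)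
      = popEigenvalue D i • (secondMoment_isHermitian D).eigenvectorBasis i := by
    apply WithLp.ofLp_injective
    rw [Matrix.ofLp_toEuclideanCLM, h]
    rfl
  rw [h2, norm_smul, (OrthonormalBasis.orthonormal _).norm_eq_one i, mul_one, mul_one,
    Real.norm_eq_abs, abs_of_nonneg (popEigenvalue_nonneg hD i)] at h1
  exact h1

theorem dotProduct_cfc_eq (f : ℝ → ℝ) (u : Fin P → ℝ) :
    u ⬝ᵥ ((secondMoment_isHermitian D).cfc f *ᵥ u)
      = ∑ i, f (popEigenvalue D i) * (u ⬝ᵥ popEigenvector D i) ^ 2 := by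
  rw [dotProduct_cfc_mulVec]
  simp only [sq]
  rfl

theorem dotProduct_secondMoment_eq (u : Fin P → ℝ) :
    u ⬝ᵥ (secondMoment D *ᵥ u) = ∑ i, popEigenvalue D i * (u ⬝ᵥ popEigenvector D i) ^ 2 := by
  rw [← dotProduct_cfc_eq (fun s => s), cfc_eq_self]

theorem half_le_one_add_mul (hD : MemLp (fun x : Fin P → ℝ => x) 2 D) {t : ℝ}
    (ht : |t| * opNorm (secondMoment D) ≤ 1 / 2) (i : Fin P) :
    1 / 2 ≤ 1 + t * popEigenvalue D i := by
  have h1 := mul_le_mul_of_nonneg_left (popEigenvalue_le_opNorm hD i) (abs_nonneg t)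
  have h2 := neg_abs_le (t * popEigenvalue D i)
  rw [abs_mul, abs_of_nonneg (popEigenvalue_nonneg hD i)] at h2
  linarith

theorem secondMoment_map_mulVec (hD : MemLp (fun x : Fin P → ℝ => x) 2 D)
    (A : Matrix (Fin P) (Fin P) ℝ) :
    secondMoment (D.map fun x => A *ᵥ x) = A * secondMoment D * Aᵀ := by
  have hm : Measurable fun x : Fin P → ℝ => A *ᵥ x :=
    (Continuous.matrix_mulVec continuous_const continuous_id).measurable
  ext i j
  have hij : Measurable fun x : Fin P → ℝ => x i * x j :=
    (measurable_pi_apply i).mul (measurable_pi_apply j)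
  have h := integral_map (μ := D) hm.aemeasurable (f := fun x : Fin P → ℝ => x i * x j)
    hij.aestronglyMeasurable
  refine h.trans ?_
  have := integral_dotProduct_mul hD (A i) (A j)
  rw [mul_assoc, mul_apply]
  simp only [dotProduct, mulVec] at this ⊢
  rw [this]
  refine Finset.sum_congr rfl fun k _ => ?_
  rw [mul_apply]
  rfl

theorem whitener_mul_mul_whitener (t : ℝ) (f : ℝ → ℝ)
    (ht : ∀ i, 1 / 2 ≤ 1 + t * popEigenvalue D i) :
    whitener D t * (secondMoment_isHermitian D).cfc f * whitener D t
      = (secondMoment_isHermitian D).cfc fun s => f s / (1 + t * s) := by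
  rw [whitener, cfc_mul_cfc, cfc_mul_cfc]
  refine cfc_congr _ fun i => ?_
  have hp : 0 < 1 + t * (secondMoment_isHermitian D).eigenvalues i :=
    lt_of_lt_of_le (by norm_num) (ht i)
  rw [mul_right_comm, ← Real.rpow_add hp]
  norm_num
  rw [Real.rpow_neg_one]
  ring

theorem transpose_whitener (t : ℝ) : (whitener D t)ᵀ = whitener D t := transpose_cfc _ _

theorem vecMul_whitener (t : ℝ) (β : Fin P → ℝ) : β ᵥ* whitener D t = whitener D t *ᵥ β := by
  rw [← vecMul_transpose, transpose_whitener]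

theorem whitener_mul_one_add_mul (t : ℝ) (ht : ∀ i, 1 / 2 ≤ 1 + t * popEigenvalue D i) :
    whitener D t * (1 + t • secondMoment D) * whitener D t = 1 := by
  rw [one_add_smul_eq_cfc (secondMoment_isHermitian D), whitener_mul_mul_whitener t _ ht, ←
    cfc_one (secondMoment_isHermitian D)]
  refine cfc_congr _ fun i => div_self ?_
  have : 1 / 2 ≤ 1 + t * (secondMoment_isHermitian D).eigenvalues i := ht i
  linarith

theorem secondMoment_transformedLaw (hD : MemLp (fun x : Fin P → ℝ => x) 2 D) (t : ℝ) :
    secondMoment (transformedLaw D t) = whitener D t * secondMoment D * whitener D t := by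
  rw [transformedLaw, secondMoment_map_mulVec hD, transpose_whitener]

theorem sum_popEigenvalue_transformedLaw (hD : MemLp (fun x : Fin P → ℝ => x) 2 D) {t : ℝ}
    (ht : ∀ i, 1 / 2 ≤ 1 + t * popEigenvalue D i) (g : ℝ → ℝ) :
    ∑ i, g (popEigenvalue (transformedLaw D t) i)
      = ∑ i, g (popEigenvalue D i / (1 + t * popEigenvalue D i)) := by
  refine sum_eigenvalues_cfc (secondMoment_isHermitian D) (f := fun s => s / (1 + t * s)) _ ?_ g
  rw [← whitener_mul_mul_whitener t (fun s => s) ht, cfc_eq_self, secondMoment_transformedLaw hD]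

theorem transformedLaw_zero : transformedLaw D 0 = D := by
  have h : whitener D 0 = 1 := by
    rw [whitener, ← cfc_one (secondMoment_isHermitian D)]
    exact cfc_congr _ fun i => by simp
  simp [transformedLaw, h]

/-- The quadratic form of a resolvent after whitening. -/
theorem whitened_quadraticForm (t : ℝ) (ht : ∀ i, 1 / 2 ≤ 1 + t * popEigenvalue D i) {μ : ℝ}
    (hμ : 0 < μ) (B : Matrix (Fin P) (Fin P) ℝ) (β : Fin P → ℝ) :
    (whitener D t *ᵥ β) ⬝ᵥ ((μ • (μ • (1 : Matrix (Fin P) (Fin P) ℝ)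
        + whitener D t * B * whitener D t)⁻¹) *ᵥ (whitener D t *ᵥ β))
      = β ⬝ᵥ ((1 + t • secondMoment D + μ⁻¹ • B)⁻¹ *ᵥ β) := by
  set A := whitener D t with hAdef
  have hA1 : A * (1 + t • secondMoment D) * A = 1 := whitener_mul_one_add_mul t ht
  have hunit : IsUnit A.det := by
    have := Matrix.isUnit_det_of_right_inverse ((mul_assoc _ _ _).symm.trans hA1)
    exact this
  have hinv : (μ • (1 : Matrix (Fin P) (Fin P) ℝ))⁻¹ = μ⁻¹ • 1 :=
    Matrix.inv_eq_right_inv (by rw [smul_mul_smul_comm, mul_one, mul_inv_cancel₀ hμ.ne', one_smul])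
  have h1 : μ • (1 : Matrix (Fin P) (Fin P) ℝ) + A * B * A
      = A * ((μ • (1 : Matrix (Fin P) (Fin P) ℝ)) * (1 + t • secondMoment D + μ⁻¹ • B)) * A := by
    have : (μ • (1 : Matrix (Fin P) (Fin P) ℝ)) * (1 + t • secondMoment D + μ⁻¹ • B)
        = μ • (1 + t • secondMoment D) + B := by
      rw [smul_mul_assoc, one_mul, smul_add μ (1 + t • secondMoment D), smul_smul,
        mul_inv_cancel₀ hμ.ne', one_smul]
    rw [this, mul_add, add_mul, mul_smul_comm, smul_mul_assoc, hA1]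
  have h2 : A * (μ • (μ • (1 : Matrix (Fin P) (Fin P) ℝ) + A * B * A)⁻¹) * A
      = (1 + t • secondMoment D + μ⁻¹ • B)⁻¹ := by
    rw [h1, Matrix.mul_inv_rev, Matrix.mul_inv_rev, Matrix.mul_inv_rev, hinv, mul_smul_comm,
      mul_smul_comm, mul_one, smul_mul_assoc μ⁻¹, mul_smul_comm, mul_smul_comm, smul_smul, mul_inv_cancel₀ hμ.ne', one_smul,
      ← mul_assoc, Matrix.mul_nonsing_inv _ hunit, one_mul, mul_assoc,
      Matrix.nonsing_inv_mul _ hunit, mul_one]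
  rw [← h2, ← mulVec_mulVec, ← mulVec_mulVec, dotProduct_mulVec β, hAdef, vecMul_whitener]

/-- Undoing the whitening merges `t` with `1 / k` into a single shift, since both multiply `Σ`. -/
theorem population_quadraticForm (hD : MemLp (fun x : Fin P → ℝ => x) 2 D) {t : ℝ}
    (ht : ∀ i, 1 / 2 ≤ 1 + t * popEigenvalue D i) {k : ℝ} (hk : 0 < k) (β : Fin P → ℝ) :
    (whitener D t *ᵥ β) ⬝ᵥ ((k • (k • (1 : Matrix (Fin P) (Fin P) ℝ)
        + secondMoment (transformedLaw D t))⁻¹) *ᵥ (whitener D t *ᵥ β))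
      = ∑ i, (β ⬝ᵥ popEigenvector D i) ^ 2 / (1 + (t + 1 / k) * popEigenvalue D i) := by
  rw [secondMoment_transformedLaw hD, whitened_quadraticForm t ht hk, add_assoc, ← add_smul,
    inv_one_add_smul (secondMoment_isHermitian D), dotProduct_cfc_eq]
  · refine Finset.sum_congr rfl fun i _ => ?_
    rw [one_div k]
    ring
  · exact fun i => one_add_pos (popEigenvalue_nonneg hD i) (ht i) (inv_pos.2 hk).le

/-- In the eigenbasis, `σ / (1 + t σ)² ≤ 4 σ`. After division by `2 √(βᵀΣβ)`, the whitened `β` is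
thus admissible in the local law. -/
theorem whitened_variance_le (hD : MemLp (fun x : Fin P → ℝ => x) 2 D) {t : ℝ}
    (ht : ∀ i, 1 / 2 ≤ 1 + t * popEigenvalue D i) (β : Fin P → ℝ) :
    (whitener D t *ᵥ β) ⬝ᵥ (secondMoment (transformedLaw D t) *ᵥ (whitener D t *ᵥ β))
      ≤ 4 * (β ⬝ᵥ (secondMoment D *ᵥ β)) := by
  have h : whitener D t * secondMoment (transformedLaw D t) * whitener D t
      = (secondMoment_isHermitian D).cfc fun s => s / (1 + t * s) / (1 + t * s) := by
    rw [secondMoment_transformedLaw hD, ← whitener_mul_mul_whitener t _ ht,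
      ← whitener_mul_mul_whitener t (fun s => s) ht, cfc_eq_self]
  have e : (whitener D t *ᵥ β) ⬝ᵥ (secondMoment (transformedLaw D t) *ᵥ (whitener D t *ᵥ β))
      = β ⬝ᵥ ((whitener D t * secondMoment (transformedLaw D t) * whitener D t) *ᵥ β) := by
    rw [← mulVec_mulVec, ← mulVec_mulVec, dotProduct_mulVec β, vecMul_whitener]
  rw [e, h, dotProduct_cfc_eq, dotProduct_secondMoment_eq, Finset.mul_sum]
  refine Finset.sum_le_sum fun i _ => ?_
  rw [← mul_assoc]
  refine mul_le_mul_of_nonneg_right ?_ (sq_nonneg _)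
  have h1 := ht i
  have h2 := popEigenvalue_nonneg hD i
  rw [div_div, div_le_iff₀ (by nlinarith)]
  have h3 : 1 ≤ 4 * ((1 + t * popEigenvalue D i) * (1 + t * popEigenvalue D i)) := by nlinarith
  nlinarith [mul_le_mul_of_nonneg_left h3 h2]

end SecondMoment

section EffectiveReg

variable {P : ℕ} {D : Measure (Fin P → ℝ)}

/-! ### The effective regularization -/

/-- The transformed spectrum is `σ / (1 + t σ)`, and clearing denominators leaves `k (1 + (t + 1 /
k) σ)`. In the variable `1 / k` the transformation is therefore a translation by `t`. -/
theorem isEffectiveReg_transformedLaw_iff (hD : MemLp (fun x : Fin P → ℝ => x) 2 D) {t : ℝ}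
    (ht : ∀ i, 1 / 2 ≤ 1 + t * popEigenvalue D i) (N : ℕ) {μ k : ℝ} (hk : 0 < k) :
    IsEffectiveReg (transformedLaw D t) N μ k
      ↔ IsFixedInv (1 / (N : ℝ)) (popEigenvalue D) t μ (1 / k) := by
  have e : μ / k + 1 / (N : ℝ) * ∑ i, popEigenvalue (transformedLaw D t) i
        / (k + popEigenvalue (transformedLaw D t) i)
      = 1 / k * (μ + stieltjesSum (1 / (N : ℝ)) (popEigenvalue D) (t + 1 / k)) := by
    rw [sum_popEigenvalue_transformedLaw hD ht fun s => s / (k + s), stieltjesSum, mul_add,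
      mul_left_comm (1 / k), Finset.mul_sum (a := 1 / k)]
    congr 1
    · ring
    congr 1
    refine Finset.sum_congr rfl fun i _ => ?_
    have h1 : 1 + t * popEigenvalue D i ≠ 0 := (lt_of_lt_of_le (by norm_num) (ht i)).ne'
    have h2 := one_add_pos (popEigenvalue_nonneg hD i) (ht i) (one_div_pos.2 hk).le
    have h3 : k * (1 + t * popEigenvalue D i) + popEigenvalue D i
        = k * (1 + (t + 1 / k) * popEigenvalue D i) := by
      field_simp
      ring
    rw [add_div' _ _ _ h1, div_div_div_cancel_right₀ h1, h3, div_mul_div_comm, one_mul]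
  unfold IsEffectiveReg IsFixedInv
  rw [e]
  simp only [hk, one_div_pos.2 hk, true_and]
  exact eq_comm

theorem isFixedInv_effectiveReg (hD : MemLp (fun x : Fin P → ℝ => x) 2 D) {t : ℝ}
    (ht : ∀ i, 1 / 2 ≤ 1 + t * popEigenvalue D i) (N : ℕ) {μ : ℝ} (hμ : 0 < μ) :
    0 < effectiveReg (transformedLaw D t) N μ ∧
      IsFixedInv (1 / (N : ℝ)) (popEigenvalue D) t μ
        (1 / effectiveReg (transformedLaw D t) N μ) := by
  obtain ⟨w, hw⟩ := exists_isFixedInv (c := 1 / (N : ℝ)) (by positivity)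
    (popEigenvalue_nonneg hD) hμ ht
  have h : IsEffectiveReg (transformedLaw D t) N μ (effectiveReg (transformedLaw D t) N μ) := by
    refine Classical.epsilon_spec (p := IsEffectiveReg (transformedLaw D t) N μ) ⟨1 / w, ?_⟩
    rw [isEffectiveReg_transformedLaw_iff hD ht N (one_div_pos.2 hw.1), one_div_one_div]
    exact hw
  exact ⟨h.1, (isEffectiveReg_transformedLaw_iff hD ht N h.1).1 h⟩

theorem abs_effectiveReg_sub_le (hD : MemLp (fun x : Fin P → ℝ => x) 2 D) {t : ℝ}
    (ht : ∀ i, 1 / 2 ≤ 1 + t * popEigenvalue D i) (N : ℕ) {μ₁ μ₂ : ℝ} (hμ₁ : 0 < μ₁)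
    (hμ₂ : 0 < μ₂) :
    |effectiveReg (transformedLaw D t) N μ₂ - effectiveReg (transformedLaw D t) N μ₁|
      ≤ effectiveReg (transformedLaw D t) N μ₁ / μ₁ * |μ₂ - μ₁| := by
  obtain ⟨k1, h1⟩ := isFixedInv_effectiveReg hD ht N hμ₁
  obtain ⟨k2, h2⟩ := isFixedInv_effectiveReg hD ht N hμ₂
  have h := h1.abs_sub_le (by positivity) (popEigenvalue_nonneg hD) hμ₁ ht ht h2
  set a := effectiveReg (transformedLaw D t) N μ₁
  set b := effectiveReg (transformedLaw D t) N μ₂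
  rw [sub_self, abs_zero, add_zero, abs_sub_comm μ₁] at h
  have e : |1 / b - 1 / a| = |b - a| / (a * b) := by
    rw [div_sub_div _ _ k2.ne' k1.ne', abs_div, abs_of_pos (mul_pos k2 k1), abs_sub_comm b]
    ring_nf
  rw [e] at h
  have h4 : μ₁ * |b - a| ≤ a * |μ₂ - μ₁| := by
    have := mul_le_mul_of_nonneg_left h (mul_pos (mul_pos k1 k1) k2).le
    have e1 : a * a * b * (1 / a * μ₁ * (|b - a| / (a * b))) = μ₁ * |b - a| := by field_simp
    have e2 : a * a * b * (1 / a * (1 / b) * |μ₂ - μ₁|) = a * |μ₂ - μ₁| := by field_simp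
    rwa [e1, e2] at this
  rw [div_mul_eq_mul_div, le_div_iff₀ hμ₁]
  linarith

theorem effectiveRegDeriv_le (hD : MemLp (fun x : Fin P → ℝ => x) 2 D) {t : ℝ}
    (ht : ∀ i, 1 / 2 ≤ 1 + t * popEigenvalue D i) (N : ℕ) {μ : ℝ} (hμ : 0 < μ) :
    effectiveRegDeriv (transformedLaw D t) N μ ≤ effectiveReg (transformedLaw D t) N μ / μ := by
  have hk := (isFixedInv_effectiveReg hD ht N hμ).1
  refine (le_abs_self _).trans ?_
  rw [← Real.norm_eq_abs]
  refine norm_deriv_le_of_lip' (div_pos hk hμ).le ?_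
  filter_upwards [lt_mem_nhds hμ] with ν hν
  exact abs_effectiveReg_sub_le hD ht N hμ hν

/-- The error scale of the local law is at most `1 / μ`. -/
theorem errorScale_le (hD : MemLp (fun x : Fin P → ℝ => x) 2 D) {t : ℝ}
    (ht : ∀ i, 1 / 2 ≤ 1 + t * popEigenvalue D i) (N : ℕ) {μ : ℝ} (hμ : 0 < μ) :
    1 / effectiveReg (transformedLaw D t) N μ * √(effectiveRegDeriv (transformedLaw D t) N μ)
      ≤ 1 / μ := by
  obtain ⟨hk, h⟩ := isFixedInv_effectiveReg hD ht N hμ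
  have h1 := effectiveRegDeriv_le hD ht N hμ
  have h2 := h.le (by positivity) (popEigenvalue_nonneg hD) ht
  set k := effectiveReg (transformedLaw D t) N μ
  have hμk : μ ≤ k := by
    rw [div_mul_eq_mul_div, one_mul, div_le_one hk] at h2
    exact h2
  -- The derivative is at most `k / μ`, hence at most `(k / μ)²` because `k ≥ μ`.
  have h3 : √(effectiveRegDeriv (transformedLaw D t) N μ) ≤ k / μ := by
    rw [Real.sqrt_le_left (div_pos hk hμ).le]
    refine h1.trans ?_
    have : 1 ≤ k / μ := (one_le_div hμ).2 hμk
    nlinarith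
  calc 1 / k * √(effectiveRegDeriv (transformedLaw D t) N μ) ≤ 1 / k * (k / μ) :=
        mul_le_mul_of_nonneg_left h3 (one_div_pos.2 hk).le
    _ = 1 / μ := by field_simp

/-- The divided-difference identity at equal `t`. The factor `(1 - Q)⁻¹` is the one in
`hasDerivAt_sum_fixedInv`; this is how `∂κ/∂λ` enters the omniscient risk. -/
theorem effectiveRegDeriv_eq (hD : MemLp (fun x : Fin P → ℝ => x) 2 D) (N : ℕ) {μ : ℝ}
    (hμ : 0 < μ) :
    effectiveRegDeriv D N μ = (1 - mixedSum (1 / (N : ℝ)) (popEigenvalue D)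
      (1 / effectiveReg D N μ) (1 / effectiveReg D N μ) (1 / effectiveReg D N μ)
      (1 / effectiveReg D N μ))⁻¹ := by
  have ht : ∀ i, 1 / 2 ≤ 1 + (0 : ℝ) * popEigenvalue D i := fun i => by norm_num
  have hσ := popEigenvalue_nonneg hD
  have hfix : ∀ ν : ℝ, 0 < ν → 0 < effectiveReg D N ν ∧
      IsFixedInv (1 / (N : ℝ)) (popEigenvalue D) 0 ν (1 / effectiveReg D N ν) := fun ν hν => by
    simpa only [transformedLaw_zero] using isFixedInv_effectiveReg hD ht N hν
  have hlip : ∀ ν : ℝ, 0 < ν → |effectiveReg D N ν - effectiveReg D N μ|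
      ≤ effectiveReg D N μ / μ * |ν - μ| := fun ν hν => by
    simpa only [transformedLaw_zero] using abs_effectiveReg_sub_le hD ht N hμ hν
  obtain ⟨hk, h0⟩ := hfix μ hμ
  have hcont : ContinuousAt (effectiveReg D N) μ := by
    have hlim : Tendsto (fun ν : ℝ => effectiveReg D N μ / μ * |ν - μ|) (𝓝 μ) (𝓝 0) := by
      have : ContinuousAt (fun ν : ℝ => effectiveReg D N μ / μ * |ν - μ|) μ := by fun_prop
      simpa [ContinuousAt] using this
    refine tendsto_iff_dist_tendsto_zero.2 (squeeze_zero'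
      (Eventually.of_forall fun _ => dist_nonneg) ?_ hlim)
    filter_upwards [lt_mem_nhds hμ] with ν hν
    exact hlip ν hν
  have hcw : ContinuousAt (fun ν => 1 / effectiveReg D N ν) μ :=
    continuousAt_const.div hcont hk.ne'
  have hpos : ∀ i, 0 < 1 + 1 / effectiveReg D N μ * popEigenvalue D i := fun i => by
    simpa using one_add_pos (hσ i) (ht i) h0.1.le
  have hQ := h0.one_sub_mixedSum (by positivity) hσ ht ht h0
  simp only [zero_add] at hQ
  have hg : ContinuousAt (fun ν => (1 - mixedSum (1 / (N : ℝ)) (popEigenvalue D)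
      (1 / effectiveReg D N μ) (1 / effectiveReg D N ν) (1 / effectiveReg D N μ)
      (1 / effectiveReg D N ν))⁻¹) μ :=
    ContinuousAt.inv₀ (continuousAt_const.sub (continuousAt_mixedSum hcw hcw hpos hpos))
      (lt_of_lt_of_le (mul_pos h0.1 hμ) hQ).ne'
  refine (hasDerivAt_of_eq_add_mul hg ?_).deriv
  filter_upwards [lt_mem_nhds hμ] with ν hν
  obtain ⟨hkν, hν'⟩ := hfix ν hν
  have e := h0.sub_eq hσ ht ht hν'
  have hQν := h0.one_sub_mixedSum (by positivity) hσ ht ht hν'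
  simp only [zero_add, sub_self, zero_mul, add_zero] at e hQν
  have hQ' := (lt_of_lt_of_le (mul_pos h0.1 hμ) hQν).ne'
  set Q := mixedSum (1 / (N : ℝ)) (popEigenvalue D)
      (1 / effectiveReg D N μ) (1 / effectiveReg D N ν) (1 / effectiveReg D N μ)
      (1 / effectiveReg D N ν)
  have e1 : (effectiveReg D N ν - effectiveReg D N μ) * (1 - Q) = ν - μ := by
    have h := congrArg (fun x => x * (effectiveReg D N μ * effectiveReg D N ν)) e
    have e2 : (1 / effectiveReg D N ν - 1 / effectiveReg D N μ) * (1 - Q)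
        * (effectiveReg D N μ * effectiveReg D N ν)
        = (effectiveReg D N μ - effectiveReg D N ν) * (1 - Q) := by
      field_simp
    have e3 : 1 / effectiveReg D N μ * (1 / effectiveReg D N ν) * (μ - ν)
        * (effectiveReg D N μ * effectiveReg D N ν) = μ - ν := by
      field_simp
    simp only [e2, e3] at h
    linarith
  rw [← e1, mul_assoc, mul_inv_cancel₀ hQ']
  ring

/-- The population quadratic form has the derivative `-omniRisk`. -/
theorem hasDerivAt_population (hD : MemLp (fun x : Fin P → ℝ => x) 2 D) (β : Fin P → ℝ) (N : ℕ)
    {μ : ℝ} (hμ : 0 < μ) :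
    HasDerivAt (fun t => ∑ i, (β ⬝ᵥ popEigenvector D i) ^ 2
        / (1 + (t + 1 / effectiveReg (transformedLaw D t) N μ) * popEigenvalue D i))
      (-omniRisk D β N μ) 0 := by
  have hσ := popEigenvalue_nonneg hD
  have hev : ∀ᶠ t in 𝓝 (0 : ℝ), (∀ i, 1 / 2 ≤ 1 + t * popEigenvalue D i) ∧
      IsFixedInv (1 / (N : ℝ)) (popEigenvalue D) t μ
        (1 / effectiveReg (transformedLaw D t) N μ) := by
    have hc : ContinuousAt (fun t : ℝ => |t| * opNorm (secondMoment D)) 0 := by fun_prop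
    have := hc.eventually (gt_mem_nhds (show |(0 : ℝ)| * opNorm (secondMoment D) < 1 / 2 by
      norm_num))
    filter_upwards [this] with t ht
    have h := half_le_one_add_mul hD ht.le
    exact ⟨h, (isFixedInv_effectiveReg hD h N hμ).2⟩
  have h := hasDerivAt_sum_fixedInv (by positivity) hσ (fun i => (β ⬝ᵥ popEigenvector D i) ^ 2)
    hμ hev
  have hk := (isFixedInv_effectiveReg hD (t := 0) (fun i => by norm_num) N hμ).1
  simp only [transformedLaw_zero] at h hk
  rw [← effectiveRegDeriv_eq hD N hμ] at h
  convert h using 2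
  rw [omniRisk, mul_assoc]
  congr 1
  rw [Finset.mul_sum]
  refine Finset.sum_congr rfl fun i _ => ?_
  have h1 : effectiveReg D N μ + popEigenvalue D i
      = effectiveReg D N μ * (1 + 1 / effectiveReg D N μ * popEigenvalue D i) := by
    field_simp
  have h2 : 0 < effectiveReg D N μ + popEigenvalue D i := add_pos_of_pos_of_nonneg hk (hσ i)
  have h3 : 1 + 1 / effectiveReg D N μ * popEigenvalue D i ≠ 0 := by
    intro h0
    rw [h1, h0, mul_zero] at h2
    exact lt_irrefl _ h2
  rw [h1]
  field_simp

end EffectiveReg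

/-! ### The ridge estimator -/

section Ridge

variable {P N : ℕ}

theorem sum_sq_eq_empSecondMoment (X : Fin N → Fin P → ℝ) (u : Fin P → ℝ) :
    1 / (N : ℝ) * ∑ i, (u ⬝ᵥ X i) ^ 2 = u ⬝ᵥ (empSecondMoment X *ᵥ u) := by
  have h : of X *ᵥ u = fun i => u ⬝ᵥ X i := by
    funext i
    rw [dotProduct_comm]
    rfl
  rw [empSecondMoment, smul_mulVec, dotProduct_smul, ← mulVec_mulVec, dotProduct_mulVec,
    vecMul_transpose, h, smul_eq_mul, dotProduct]
  simp only [sq]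

theorem empSecondMoment_posSemidef (X : Fin N → Fin P → ℝ) : (empSecondMoment X).PosSemidef :=
  Matrix.PosSemidef.of_dotProduct_mulVec_nonneg (empSecondMoment_isHermitian X) fun u => by
    rw [star_trivial, ← sum_sq_eq_empSecondMoment]
    positivity

theorem one_add_smul_empSecondMoment_posDef (X : Fin N → Fin P → ℝ) {r : ℝ} (hr : 0 ≤ r) :
    (1 + r • empSecondMoment X).PosDef :=
  Matrix.PosDef.one.add_posSemidef ((empSecondMoment_posSemidef X).smul hr)

theorem dotProduct_mulVec_comm_of_isHermitian {n : Type*} [Fintype n] {A : Matrix n n ℝ}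
    (hA : A.IsHermitian) (u v : n → ℝ) : u ⬝ᵥ (A *ᵥ v) = (A *ᵥ u) ⬝ᵥ v := by
  have h : Aᵀ = A := by
    rw [← conjTranspose_eq_transpose_of_trivial]
    exact hA
  rw [dotProduct_mulVec, ← mulVec_transpose, h]

theorem sub_ridgeEstimator (X : Fin N → Fin P → ℝ) (β : Fin P → ℝ) {lam : ℝ} (hlam : 0 < lam) :
    β - ridgeEstimator X (labels β X) lam = (1 + lam⁻¹ • empSecondMoment X)⁻¹ *ᵥ β := by
  set S := empSecondMoment X with hS
  have hpd := one_add_smul_empSecondMoment_posDef X (inv_pos.2 hlam).le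
  rw [← hS] at hpd
  set u := (1 + lam⁻¹ • S)⁻¹ *ᵥ β with hu
  have hinv : u + lam⁻¹ • (S *ᵥ u) = β := by
    have : (1 + lam⁻¹ • S) *ᵥ u = β := by
      rw [hu, mulVec_mulVec, Matrix.mul_nonsing_inv _ hpd.det_pos.ne'.isUnit, one_mulVec]
    rwa [add_mulVec, one_mulVec, smul_mulVec] at this
  have hSu : S *ᵥ u = lam • (β - u) := by
    rw [← hinv, add_sub_cancel_left, smul_smul, mul_inv_cancel₀ hlam.ne', one_smul]
  have hobj : ∀ b, ridgeObjective X (labels β X) lam b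
      = (β - b) ⬝ᵥ (S *ᵥ (β - b)) + lam * (b ⬝ᵥ b) := by
    intro b
    rw [ridgeObjective, hS, ← sum_sq_eq_empSecondMoment]
    simp only [labels, sub_dotProduct]
    simp only [dotProduct, sq]
  -- Completing the square around `β - u`. The excess is a positive definite form, so the chosen
  -- minimizer must be this point.
  have hexp : ∀ b, ridgeObjective X (labels β X) lam b
      = ridgeObjective X (labels β X) lam (β - u)
        + ((u - (β - b)) ⬝ᵥ (S *ᵥ (u - (β - b)))
          + lam * ((u - (β - b)) ⬝ᵥ (u - (β - b)))) := by
    intro b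
    obtain ⟨d, hd⟩ : ∃ d, u - (β - b) = d := ⟨_, rfl⟩
    have hb : b = β - u + d := by rw [← hd]; abel
    have hb' : β - b = u - d := by rw [hb]; abel
    have hc : u ⬝ᵥ (S *ᵥ d) = lam * ((β - u) ⬝ᵥ d) := by
      rw [dotProduct_mulVec_comm_of_isHermitian (empSecondMoment_isHermitian X), ← hS, hSu,
        smul_dotProduct, smul_eq_mul]
    have hc' : d ⬝ᵥ (S *ᵥ u) = lam * ((β - u) ⬝ᵥ d) := by
      rw [hSu, dotProduct_smul, smul_eq_mul, dotProduct_comm]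
    rw [hobj, hobj, hd, hb', hb, sub_sub_cancel]
    generalize β - u = e at *
    simp only [mulVec_sub, dotProduct_sub, sub_dotProduct, dotProduct_add, add_dotProduct, hc, hc',
      dotProduct_comm d e]
    ring
  have hsq : ∀ d : Fin P → ℝ, 0 ≤ d ⬝ᵥ d := fun d =>
    Finset.sum_nonneg fun i _ => mul_self_nonneg (d i)
  have hnn : ∀ d : Fin P → ℝ, 0 ≤ d ⬝ᵥ (S *ᵥ d) := fun d => by
    simpa using (empSecondMoment_posSemidef X).dotProduct_mulVec_nonneg d
  have hmin : IsMinOn (ridgeObjective X (labels β X) lam) Set.univ (β - u) := by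
    intro b _
    rw [Set.mem_ofPred_eq, hexp b]
    have := hsq (u - (β - b))
    nlinarith [hnn (u - (β - b)), mul_nonneg hlam.le this]
  have hspec : IsMinOn (ridgeObjective X (labels β X) lam) Set.univ
      (ridgeEstimator X (labels β X) lam) :=
    Classical.epsilon_spec (p := fun b =>
      IsMinOn (ridgeObjective X (labels β X) lam) Set.univ b) ⟨_, hmin⟩
  have h1 := hspec (Set.mem_univ (β - u))
  rw [Set.mem_ofPred_eq, hexp (ridgeEstimator X (labels β X) lam)] at h1
  generalize ridgeEstimator X (labels β X) lam = b at *
  have h2 : (u - (β - b)) ⬝ᵥ (u - (β - b)) = 0 := by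
    have := hsq (u - (β - b))
    nlinarith [hnn (u - (β - b))]
  exact (sub_eq_zero.1 (dotProduct_self_eq_zero.1 h2)).symm

theorem empSecondMoment_mulVec (X : Fin N → Fin P → ℝ) (A : Matrix (Fin P) (Fin P) ℝ) :
    empSecondMoment (fun i => A *ᵥ X i) = A * empSecondMoment X * Aᵀ := by
  have h : of (fun i => A *ᵥ X i) = of X * Aᵀ := by
    ext i j
    simp [mul_apply, mulVec, dotProduct, mul_comm]
  rw [empSecondMoment, h, transpose_mul, transpose_transpose, empSecondMoment, mul_smul_comm,
    smul_mul_assoc]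
  simp only [Matrix.mul_assoc]

end Ridge

section Sample

variable {P N : ℕ} {D : Measure (Fin P → ℝ)}

/-! ### Taylor approximation on the side of the sample -/

/-- The scaled design matrix `X / √(N lam)` as an operator. -/
noncomputable def designOperator (X : Fin N → Fin P → ℝ) (lam : ℝ) :
    EuclideanSpace ℝ (Fin P) →L[ℝ] EuclideanSpace ℝ (Fin N) :=
  LinearMap.toContinuousLinearMap (Matrix.toEuclideanLin (√(lam⁻¹ * (1 / N)) • of X))

theorem inner_designOperator (X : Fin N → Fin P → ℝ) {lam : ℝ} (hlam : 0 < lam)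
    (u v : EuclideanSpace ℝ (Fin P)) :
    inner ℝ (designOperator X lam u) (designOperator X lam v)
      = u.ofLp ⬝ᵥ ((lam⁻¹ • empSecondMoment X) *ᵥ v.ofLp) := by
  have h : ∀ w : EuclideanSpace ℝ (Fin P), (designOperator X lam w).ofLp
      = (√(lam⁻¹ * (1 / N)) • of X) *ᵥ w.ofLp := fun w => rfl
  rw [EuclideanSpace.inner_eq_star_dotProduct, star_trivial, h, h, dotProduct_comm, empSecondMoment,
    smul_smul, ← Real.mul_self_sqrt (show 0 ≤ lam⁻¹ * (1 / (N : ℝ)) by positivity)]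
  simp only [smul_mulVec, dotProduct_smul, smul_dotProduct, smul_eq_mul]
  rw [← mulVec_mulVec, dotProduct_mulVec _ (of X)ᵀ, vecMul_transpose, Real.mul_self_sqrt
    (show 0 ≤ lam⁻¹ * (1 / (N : ℝ)) by positivity), ← mul_assoc, Real.mul_self_sqrt
    (show 0 ≤ lam⁻¹ * (1 / (N : ℝ)) by positivity)]

theorem adjoint_comp_designOperator (X : Fin N → Fin P → ℝ) {lam : ℝ} (hlam : 0 < lam) :
    (designOperator X lam).adjoint.comp (designOperator X lam)
      = Matrix.toEuclideanCLM (n := Fin P) (𝕜 := ℝ) (lam⁻¹ • empSecondMoment X) := by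
  refine ContinuousLinearMap.ext fun v => ext_inner_left ℝ fun u => ?_
  rw [ContinuousLinearMap.comp_apply, ContinuousLinearMap.adjoint_inner_right,
    inner_designOperator X hlam, Matrix.inner_toEuclideanCLM]

/-- The Taylor coefficients of the sample quadratic form, relative to its value for an infinite
regularization. -/
noncomputable def sampleCoeff (D : Measure (Fin P → ℝ)) (X : Fin N → Fin P → ℝ) (β : Fin P → ℝ)
    (lam : ℝ) (m : ℕ) : ℝ :=
  (-1) ^ m * (β ⬝ᵥ ((((1 + lam⁻¹ • empSecondMoment X)⁻¹ * secondMoment D) ^ m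
      * (1 + lam⁻¹ • empSecondMoment X)⁻¹) *ᵥ β) - β ⬝ᵥ (secondMoment D ^ m *ᵥ β))

theorem isHermitian_inv_one_add (X : Fin N → Fin P → ℝ) {r : ℝ} (hr : 0 ≤ r) :
    ((1 + r • empSecondMoment X)⁻¹).IsHermitian :=
  (one_add_smul_empSecondMoment_posDef X hr).inv.isHermitian

/-- With `M₀ = (1 + λ⁻¹Σ̂)⁻¹` one has `β - β̂ = M₀ β`, so the quadratic form of `M₀ Σ M₀` at `β` is
the risk. -/
theorem sampleCoeff_one (hD : MemLp (fun x : Fin P → ℝ => x) 2 D) (X : Fin N → Fin P → ℝ)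
    (β : Fin P → ℝ) {lam : ℝ} (hlam : 0 < lam) :
    sampleCoeff D X β lam 1
      = β ⬝ᵥ (secondMoment D *ᵥ β) - risk D β (ridgeEstimator X (labels β X) lam) := by
  rw [risk_eq hD, sub_ridgeEstimator X β hlam, sampleCoeff, pow_one, pow_one, pow_one,
    ← mulVec_mulVec, ← mulVec_mulVec, dotProduct_mulVec_comm_of_isHermitian
      (isHermitian_inv_one_add X (inv_pos.2 hlam).le)]
  ring

theorem one_add_smul_secondMoment_posDef {t : ℝ}
    (ht : ∀ i, 1 / 2 ≤ 1 + t * popEigenvalue D i) : (1 + t • secondMoment D).PosDef := by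
  have h1 : (1 / 2 : ℝ) • (1 : Matrix (Fin P) (Fin P) ℝ)
      + ((1 / 2 : ℝ) • 1 + t • secondMoment D) = 1 + t • secondMoment D := by
    rw [← add_assoc, ← add_smul]
    norm_num
  have h2 : (1 / 2 : ℝ) • (1 : Matrix (Fin P) (Fin P) ℝ) + t • secondMoment D
      = (secondMoment_isHermitian D).cfc fun s => 1 / 2 * 1 + t * s := by
    rw [← cfc_add_cfc _ (fun _ => 1 / 2 * 1) fun s => t * s, ← smul_cfc _ t, cfc_eq_self,
      ← smul_cfc _ (1 / 2) fun _ => 1, cfc_one]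
  rw [← h1]
  refine (Matrix.PosDef.one.smul (by norm_num : (0 : ℝ) < 1 / 2)).add_posSemidef ?_
  refine Matrix.PosSemidef.of_dotProduct_mulVec_nonneg ?_ fun u => ?_
  · rw [h2, IsHermitian, conjTranspose_eq_transpose_of_trivial, transpose_cfc]
  · rw [star_trivial, h2, dotProduct_cfc_eq]
    exact Finset.sum_nonneg fun i _ => mul_nonneg (by linarith [ht i]) (sq_nonneg _)

/-- Taylor approximation of the sample quadratic form. -/
theorem abs_sample_sub_taylor_le (hD : MemLp (fun x : Fin P → ℝ => x) 2 D)
    (X : Fin N → Fin P → ℝ) (β : Fin P → ℝ) {lam t w : ℝ} (hlam : 0 < lam) (hw : 0 ≤ w)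
    (ht : |t| * opNorm (secondMoment D) ≤ 1 / 2) (n : ℕ)
    (h : ∀ j ≤ n, ∀ r ∈ ({0, t} : Set ℝ),
      ((secondMoment D ^ j * (1 + r • secondMoment D)⁻¹) *ᵥ β) ⬝ᵥ ((lam⁻¹ • empSecondMoment X) *ᵥ
        ((secondMoment D ^ j * (1 + r • secondMoment D)⁻¹) *ᵥ β))
        ≤ w * (opNorm (secondMoment D) ^ j) ^ 2) :
    |β ⬝ᵥ ((1 + t • secondMoment D + lam⁻¹ • empSecondMoment X)⁻¹ *ᵥ β)
        - ∑ i, (β ⬝ᵥ popEigenvector D i) ^ 2 / (1 + t * popEigenvalue D i)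
        - ∑ m ∈ Finset.range n, sampleCoeff D X β lam m * t ^ m|
      ≤ (n + 1) * (n + 2) * w * (opNorm (secondMoment D) * |t|) ^ n := by
  have hti := half_le_one_add_mul hD ht
  have hpos : ∀ i, 0 < 1 + t * (secondMoment_isHermitian D).eigenvalues i := fun i =>
    lt_of_lt_of_le (by norm_num) (hti i)
  let T := Matrix.toEuclideanCLM (n := Fin P) (𝕜 := ℝ)
  have hpd0 := one_add_smul_empSecondMoment_posDef X (inv_pos.2 hlam).le
  have hpdU := one_add_smul_secondMoment_posDef hti
  have hpdR := hpdU.add_posSemidef ((empSecondMoment_posSemidef X).smul (inv_pos.2 hlam).le)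
  have hK := adjoint_comp_designOperator X hlam
  have h1U : T (1 + t • secondMoment D) = 1 + t • T (secondMoment D) := by
    rw [map_add, map_one, map_smul]
  have h1M : T (1 + lam⁻¹ • empSecondMoment X)
      = 1 + (designOperator X lam).adjoint.comp (designOperator X lam) := by
    rw [hK, map_add, map_one]
  have h1R : T (1 + t • secondMoment D + lam⁻¹ • empSecondMoment X)
      = 1 + t • T (secondMoment D)
        + (designOperator X lam).adjoint.comp (designOperator X lam) := by
    rw [hK, map_add, h1U]
  have hinvl : ∀ {B : Matrix (Fin P) (Fin P) ℝ}, B.PosDef → T B⁻¹ * T B = 1 := fun {B} hB => by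
    rw [← map_mul, Matrix.nonsing_inv_mul _ hB.det_pos.ne'.isUnit, map_one]
  have hinvr : ∀ {B : Matrix (Fin P) (Fin P) ℝ}, B.PosDef → T B * T B⁻¹ = 1 := fun {B} hB => by
    rw [← map_mul, Matrix.mul_nonsing_inv _ hB.det_pos.ne'.isUnit, map_one]
  have hsymm : ∀ {B : Matrix (Fin P) (Fin P) ℝ}, B.IsHermitian →
      ∀ x y : EuclideanSpace ℝ (Fin P), inner ℝ (T B x) y = inner ℝ x (T B y) := by
    intro B hB x y
    rw [real_inner_comm]
    simp only [T]
    rw [Matrix.inner_toEuclideanCLM, Matrix.inner_toEuclideanCLM,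
      dotProduct_mulVec_comm_of_isHermitian hB, dotProduct_comm]
  have hcomm : Commute (secondMoment D) (1 + t • secondMoment D)⁻¹ := by
    have e := inv_one_add_smul (secondMoment_isHermitian D) hpos
    have e2 : ((secondMoment_isHermitian D).cfc fun s => s)
          * ((secondMoment_isHermitian D).cfc fun s => 1 / (1 + t * s))
        = ((secondMoment_isHermitian D).cfc fun s => 1 / (1 + t * s))
          * ((secondMoment_isHermitian D).cfc fun s => s) := by
      rw [cfc_mul_cfc, cfc_mul_cfc]
      simp only [mul_comm]
    rw [cfc_eq_self, ← e] at e2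
    exact e2
  have hs0 : 0 ≤ opNorm (secondMoment D) := norm_nonneg _
  have hbound : ∀ j ≤ n, ∀ r ∈ ({0, t} : Set ℝ), ‖designOperator X lam
      (T (secondMoment D ^ j * (1 + r • secondMoment D)⁻¹) (WithLp.toLp 2 β))‖
        ≤ √w * opNorm (secondMoment D) ^ j := by
    intro j hj r hr
    refine (sq_le_sq₀ (norm_nonneg _) (by positivity)).1 ?_
    rw [← real_inner_self_eq_norm_sq, inner_designOperator X hlam, mul_pow, Real.sq_sqrt hw]
    simp only [T, Matrix.ofLp_toEuclideanCLM]
    exact h j hj r hr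
  have key := abs_resolvent_sub_taylor_le (designOperator X lam) (T (secondMoment D))
    (T (1 + lam⁻¹ • empSecondMoment X)⁻¹) (T (1 + t • secondMoment D)⁻¹)
    (T (1 + t • secondMoment D + lam⁻¹ • empSecondMoment X)⁻¹) (WithLp.toLp 2 β)
    (s := opNorm (secondMoment D)) (t := t) (W := √w) hs0 (Real.sqrt_nonneg w)
    (fun x => ContinuousLinearMap.le_opNorm _ x) ht (hsymm (secondMoment_isHermitian D))
    (hsymm hpdU.inv.isHermitian) (hcomm.map T)
    (by rw [← h1M]; exact hinvl hpd0) (by rw [← h1M]; exact hinvr hpd0)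
    (by rw [← h1U]; exact hinvl hpdU) (by rw [← h1U]; exact hinvr hpdU)
    (by rw [← h1R]; exact hinvl hpdR) (by rw [← h1R]; exact hinvr hpdR) n
    (fun j hj => by
      have := hbound j hj 0 (by simp)
      rwa [zero_smul, add_zero, inv_one, mul_one, map_pow] at this)
    (fun j hj => by
      have := hbound j hj t (by simp)
      rwa [map_mul, map_pow] at this)
  have hU : ∑ i, (β ⬝ᵥ popEigenvector D i) ^ 2 / (1 + t * popEigenvalue D i)
      = β ⬝ᵥ ((1 + t • secondMoment D)⁻¹ *ᵥ β) := by
    rw [inv_one_add_smul (secondMoment_isHermitian D) hpos, dotProduct_cfc_eq]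
    exact Finset.sum_congr rfl fun i _ => by ring
  rw [Real.sq_sqrt hw] at key
  simp only [← map_pow, ← map_mul] at key
  simp only [T, Matrix.inner_toEuclideanCLM] at key
  rw [hU]
  exact key

end Sample

/-! ### From the values at the nodes to the derivative -/

/-- Inversion of the Vandermonde matrix at the integer nodes `0, …, n - 1`. The constant depends on
`n` and `i` only; the actual spacing is absorbed into the coefficients. -/
theorem exists_nodes_const {n : ℕ} (i : Fin n) : ∃ C : ℝ, 0 ≤ C ∧ ∀ (d : Fin n → ℝ) (B : ℝ),
    (∀ j : Fin n, |∑ m, d m * (j : ℝ) ^ (m : ℕ)| ≤ B) → |d i| ≤ C * B := by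
  set V := Matrix.vandermonde fun j : Fin n => (j : ℝ) with hV
  have hdet : V.det ≠ 0 := Matrix.det_vandermonde_ne_zero_iff.2 fun a b hab => by
    exact Fin.ext (by exact_mod_cast hab)
  refine ⟨∑ j, |V⁻¹ i j|, Finset.sum_nonneg fun _ _ => abs_nonneg _, fun d B hB => ?_⟩
  have h1 : d = V⁻¹ *ᵥ (V *ᵥ d) := by
    rw [mulVec_mulVec, Matrix.nonsing_inv_mul _ hdet.isUnit, one_mulVec]
  rw [h1, mulVec, dotProduct, Finset.sum_mul]
  refine (Finset.abs_sum_le_sum_abs _ _).trans (Finset.sum_le_sum fun j _ => ?_)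
  rw [abs_mul]
  refine mul_le_mul_of_nonneg_left ?_ (abs_nonneg _)
  refine le_trans (le_of_eq ?_) (hB j)
  congr 1
  rw [mulVec, dotProduct]
  exact Finset.sum_congr rfl fun m _ => by rw [hV, vandermonde_apply, mul_comm]

theorem hasDerivAt_zero_of_abs_le_sq {f : ℝ → ℝ} {C : ℝ}
    (h : ∀ᶠ t in 𝓝 (0 : ℝ), |f t| ≤ C * |t| ^ 2) : HasDerivAt f 0 0 := by
  have h0 : f 0 = 0 := by
    have := h.self_of_nhds
    simpa using this
  rw [hasDerivAt_iff_isLittleO]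
  have hO : (fun t => f t) =O[𝓝 0] fun t : ℝ => t ^ 2 := by
    refine Asymptotics.IsBigO.of_bound C ?_
    filter_upwards [h] with t ht
    simpa using ht
  have ho : (fun t : ℝ => t ^ 2) =o[𝓝 0] fun t : ℝ => t := by
    simpa using Asymptotics.isLittleO_pow_id (𝕜 := ℝ) one_lt_two
  simpa [h0] using hO.trans_isLittleO ho

/-- The compactness argument does not reveal the coefficients. The linear one is identified
afterwards: the remainder is `O(t²)` as `n ≥ 2`, so its derivative at 0 vanishes, and derivatives
are unique. -/
theorem exists_taylor_population {P : ℕ} {D : Measure (Fin P → ℝ)}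
    (hD : MemLp (fun x : Fin P → ℝ => x) 2 D) (β : Fin P → ℝ) (N : ℕ) {lam : ℝ} (hlam : 0 < lam)
    (hs : 0 < opNorm (secondMoment D)) {n : ℕ} (hn : 2 ≤ n) :
    ∃ a : Fin n → ℝ, a ⟨1, hn⟩ = β ⬝ᵥ (secondMoment D *ᵥ β) - omniRisk D β N lam ∧
      ∀ t : ℝ, |t| ≤ 1 / (4 * opNorm (secondMoment D)) →
        |∑ i, (β ⬝ᵥ popEigenvector D i) ^ 2
              / (1 + (t + 1 / effectiveReg (transformedLaw D t) N lam) * popEigenvalue D i)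
            - ∑ i, (β ⬝ᵥ popEigenvector D i) ^ 2 / (1 + t * popEigenvalue D i)
            - ∑ m : Fin n, a m * t ^ (m : ℕ)|
          ≤ 8 * (β ⬝ᵥ (secondMoment D *ᵥ β)) / lam * (2 * opNorm (secondMoment D) * |t|) ^ n := by
  set s := opNorm (secondMoment D) with hsdef
  have hσ := popEigenvalue_nonneg hD
  obtain ⟨a, ha⟩ := exists_taylor_fixedInv (c := 1 / (N : ℝ)) (by positivity) hs hlam hσ
    (popEigenvalue_le_opNorm hD) (b := fun i => (β ⬝ᵥ popEigenvector D i) ^ 2)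
    (fun i => sq_nonneg _) n
  have hq : ∑ i, (β ⬝ᵥ popEigenvector D i) ^ 2 * popEigenvalue D i
      = β ⬝ᵥ (secondMoment D *ᵥ β) := by
    rw [dotProduct_secondMoment_eq]
    exact Finset.sum_congr rfl fun i _ => mul_comm _ _
  have hbd : ∀ t : ℝ, |t| ≤ 1 / (4 * s) →
        |∑ i, (β ⬝ᵥ popEigenvector D i) ^ 2
              / (1 + (t + 1 / effectiveReg (transformedLaw D t) N lam) * popEigenvalue D i)
            - ∑ i, (β ⬝ᵥ popEigenvector D i) ^ 2 / (1 + t * popEigenvalue D i)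
            - ∑ m : Fin n, a m * t ^ (m : ℕ)|
          ≤ 8 * (β ⬝ᵥ (secondMoment D *ᵥ β)) / lam * (2 * s * |t|) ^ n := by
    intro t ht
    have hts : |t| * s ≤ 1 / 2 := by
      rw [le_div_iff₀ (by positivity)] at ht
      linarith
    have h := ha t _ ht (isFixedInv_effectiveReg hD (half_le_one_add_mul hD hts) N hlam).2
    rw [hq] at h
    refine h.trans_eq ?_
    ring
  refine ⟨a, ?_, hbd⟩
  have h1 := hasDerivAt_population hD β N hlam
  have h2 : HasDerivAt (fun t : ℝ => ∑ i, (β ⬝ᵥ popEigenvector D i) ^ 2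
      / (1 + t * popEigenvalue D i)) (-(β ⬝ᵥ (secondMoment D *ᵥ β))) 0 := by
    rw [← hq, ← Finset.sum_neg_distrib]
    refine HasDerivAt.fun_sum fun i _ => ?_
    have h := (((hasDerivAt_id (0 : ℝ)).mul_const (popEigenvalue D i)).const_add 1).fun_inv
      (by simp)
    have h' := h.const_mul ((β ⬝ᵥ popEigenvector D i) ^ 2)
    simpa [div_eq_mul_inv] using h'
  have h3 : HasDerivAt (fun t : ℝ => ∑ m : Fin n, a m * t ^ (m : ℕ)) (a ⟨1, hn⟩) 0 := by
    have h : HasDerivAt (fun t : ℝ => ∑ m : Fin n, a m * t ^ (m : ℕ))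
        (∑ m : Fin n, a m * ((m : ℕ) * 0 ^ ((m : ℕ) - 1))) 0 :=
      HasDerivAt.fun_sum fun m _ => (hasDerivAt_pow (m : ℕ) (0 : ℝ)).const_mul (a m)
    convert h using 1
    rw [Finset.sum_eq_single (⟨1, hn⟩ : Fin n)]
    · simp
    · intro m _ hm
      have hm1 : (m : ℕ) ≠ 1 := fun h => hm (Fin.ext h)
      rcases Nat.eq_zero_or_pos (m : ℕ) with h0 | h0
      · simp [h0]
      · rw [zero_pow (by omega), mul_zero, mul_zero]
    · simp
  have h4 := (h1.sub h2).sub h3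
  have h5 : HasDerivAt (fun t : ℝ => ∑ i, (β ⬝ᵥ popEigenvector D i) ^ 2
              / (1 + (t + 1 / effectiveReg (transformedLaw D t) N lam) * popEigenvalue D i)
            - ∑ i, (β ⬝ᵥ popEigenvector D i) ^ 2 / (1 + t * popEigenvalue D i)
            - ∑ m : Fin n, a m * t ^ (m : ℕ)) 0 0 := by
    refine hasDerivAt_zero_of_abs_le_sq
      (C := 8 * (β ⬝ᵥ (secondMoment D *ᵥ β)) / lam * (2 * s) ^ 2) ?_
    have hpos : (0 : ℝ) < 1 / (4 * s) := by positivity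
    filter_upwards [(continuous_abs.tendsto (0 : ℝ)).eventually
      (gt_mem_nhds (show |(0 : ℝ)| < 1 / (4 * s) by rwa [abs_zero]))] with t ht
    refine (hbd t ht.le).trans ?_
    have hx : 2 * s * |t| ≤ 1 := by
      have := ht.le
      rw [le_div_iff₀ (by positivity)] at this
      linarith [mul_nonneg hs.le (abs_nonneg t)]
    rw [mul_assoc (8 * _ / lam), ← mul_pow]
    refine mul_le_mul_of_nonneg_left (pow_le_pow_of_le_one (by positivity) hx hn) ?_
    exact div_nonneg (mul_nonneg (by norm_num) (dotProduct_secondMoment_nonneg hD β)) hlam.le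
  have h6 := h4.unique h5
  linarith

/-! ### Comparison of the two risks for a fixed sample -/

/-- The two Taylor polynomials differ little at the nodes, by the assumed closeness `δ` and the two
remainders. Interpolation then compares their linear coefficients at the cost of one division by the
node spacing. -/
theorem abs_omniRisk_sub_risk_le {n : ℕ} (hn : 2 ≤ n) {C : ℝ}
    (hC : ∀ (d : Fin n → ℝ) (B : ℝ),
      (∀ j : Fin n, |∑ m, d m * (j : ℝ) ^ (m : ℕ)| ≤ B) → |d ⟨1, hn⟩| ≤ C * B)
    {P N : ℕ} {D : Measure (Fin P → ℝ)} (hD : MemLp (fun x : Fin P → ℝ => x) 2 D)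
    (X : Fin N → Fin P → ℝ) (β : Fin P → ℝ) {lam x δ w : ℝ} (hlam : 0 < lam) (hw : 0 ≤ w)
    (hs : 0 < opNorm (secondMoment D)) (hx0 : 0 < x) (hx1 : x ≤ 1) {t : Fin n → ℝ}
    (ht : ∀ j, t j = j * (x / (4 * n * opNorm (secondMoment D))))
    (hδ : ∀ j, |∑ i, (β ⬝ᵥ popEigenvector D i) ^ 2
          / (1 + (t j + 1 / effectiveReg (transformedLaw D (t j)) N lam) * popEigenvalue D i)
        - β ⬝ᵥ ((1 + t j • secondMoment D + lam⁻¹ • empSecondMoment X)⁻¹ *ᵥ β)| ≤ δ)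
    (h : ∀ k ≤ n, ∀ j,
      ((secondMoment D ^ k * (1 + t j • secondMoment D)⁻¹) *ᵥ β) ⬝ᵥ
        ((lam⁻¹ • empSecondMoment X) *ᵥ
          ((secondMoment D ^ k * (1 + t j • secondMoment D)⁻¹) *ᵥ β))
        ≤ w * (opNorm (secondMoment D) ^ k) ^ 2) :
    |omniRisk D β N lam - risk D β (ridgeEstimator X (labels β X) lam)|
      ≤ C * (4 * n * opNorm (secondMoment D) / x) * (δ + ((n + 1) * (n + 2) * w
        + 8 * (β ⬝ᵥ (secondMoment D *ᵥ β)) / lam) * x ^ n) := by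
  set s := opNorm (secondMoment D) with hsdef
  have hn0 : (0 : ℝ) < n := by exact_mod_cast (by omega : 0 < n)
  set y := x / (4 * n * s) with hy
  have hy0 : 0 < y := by positivity
  have hq := dotProduct_secondMoment_nonneg hD β
  set q := β ⬝ᵥ (secondMoment D *ᵥ β) with hqdef
  have hts : ∀ j, 2 * s * |t j| ≤ x / 2 := by
    intro j
    have hj : (j : ℝ) ≤ n := by exact_mod_cast j.2.le
    rw [ht, abs_of_nonneg (by positivity)]
    have : 2 * s * (n * y) = x / 2 := by
      rw [hy]
      field_simp
      norm_num
    rw [← this]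
    gcongr
  have hts' : ∀ j, |t j| ≤ 1 / (4 * s) := by
    intro j
    rw [le_div_iff₀ (by positivity)]
    linarith [hts j]
  obtain ⟨a, ha1, ha⟩ := exists_taylor_population hD β N hlam hs hn
  -- The node 0 supplies the moment bounds without resolvent, the case `r = 0` below.
  have h0 : t ⟨0, by omega⟩ = 0 := by rw [ht]; simp
  have hS : ∀ j, |β ⬝ᵥ ((1 + t j • secondMoment D + lam⁻¹ • empSecondMoment X)⁻¹ *ᵥ β)
        - ∑ i, (β ⬝ᵥ popEigenvector D i) ^ 2 / (1 + t j * popEigenvalue D i)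
        - ∑ m : Fin n, sampleCoeff D X β lam m * t j ^ (m : ℕ)|
      ≤ (n + 1) * (n + 2) * w * (s * |t j|) ^ n := by
    intro j
    have := abs_sample_sub_taylor_le hD X β hlam hw (t := t j) (by linarith [hts j]) n
      (fun k hk r hr => by
        rcases hr with rfl | hr
        · have := h k hk ⟨0, by omega⟩
          rwa [h0] at this
        · rw [Set.mem_singleton_iff.1 hr]
          exact h k hk j)
    rwa [Finset.sum_range] at this
  have hnode : ∀ j : Fin n, |∑ m : Fin n, ((a m - sampleCoeff D X β lam m) * y ^ (m : ℕ))
        * (j : ℝ) ^ (m : ℕ)|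
      ≤ δ + ((n + 1) * (n + 2) * w + 8 * q / lam) * x ^ n := by
    intro j
    have e : ∑ m : Fin n, ((a m - sampleCoeff D X β lam m) * y ^ (m : ℕ)) * (j : ℝ) ^ (m : ℕ)
        = ∑ m : Fin n, a m * t j ^ (m : ℕ) - ∑ m : Fin n, sampleCoeff D X β lam m * t j ^ (m : ℕ) := by
      rw [← Finset.sum_sub_distrib]
      refine Finset.sum_congr rfl fun m _ => ?_
      rw [ht, mul_pow]
      ring
    rw [e]
    have b1 := ha (t j) (hts' j)
    have b2 := hS j
    have b3 := hδ j
    have c1 : (2 * s * |t j|) ^ n ≤ x ^ n :=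
      pow_le_pow_left₀ (by positivity) (by linarith [hts j]) n
    have c2 : (s * |t j|) ^ n ≤ x ^ n :=
      pow_le_pow_left₀ (by positivity) (by linarith [hts j]) n
    have d1 := mul_le_mul_of_nonneg_left c1 (show 0 ≤ 8 * q / lam by positivity)
    have d2 := mul_le_mul_of_nonneg_left c2
      (show 0 ≤ ((n : ℝ) + 1) * (n + 2) * w by positivity)
    generalize ∑ i, (β ⬝ᵥ popEigenvector D i) ^ 2
      / (1 + (t j + 1 / effectiveReg (transformedLaw D (t j)) N lam) * popEigenvalue D i) = g at *
    generalize β ⬝ᵥ ((1 + t j • secondMoment D + lam⁻¹ • empSecondMoment X)⁻¹ *ᵥ β) = f at *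
    generalize ∑ i, (β ⬝ᵥ popEigenvector D i) ^ 2 / (1 + t j * popEigenvalue D i) = u at *
    rw [abs_le] at *
    constructor <;> nlinarith
  have hfin := hC (fun m => (a m - sampleCoeff D X β lam m) * y ^ (m : ℕ)) _ hnode
  simp only [pow_one, ha1, sampleCoeff_one hD X β hlam] at hfin
  -- Both linear coefficients are `βᵀΣβ` minus a risk, so `βᵀΣβ` cancels.
  rw [abs_mul, abs_of_pos hy0, ← le_div_iff₀ hy0, sub_sub_sub_cancel_left, abs_sub_comm] at hfin
  refine hfin.trans_eq ?_
  rw [hy]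
  field_simp

theorem node_variance_le {P : ℕ} {D : Measure (Fin P → ℝ)}
    (hD : MemLp (fun x : Fin P → ℝ => x) 2 D) (β : Fin P → ℝ) {t : ℝ}
    (ht : ∀ i, 1 / 2 ≤ 1 + t * popEigenvalue D i) (k : ℕ) :
    ((secondMoment D ^ k * (1 + t • secondMoment D)⁻¹) *ᵥ β) ⬝ᵥ (secondMoment D *ᵥ
        ((secondMoment D ^ k * (1 + t • secondMoment D)⁻¹) *ᵥ β))
      ≤ 4 * (opNorm (secondMoment D) ^ k) ^ 2 * (β ⬝ᵥ (secondMoment D *ᵥ β)) := by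
  have hA : secondMoment D ^ k * (1 + t • secondMoment D)⁻¹
      = (secondMoment_isHermitian D).cfc fun s => s ^ k * (1 / (1 + t * s)) := by
    rw [inv_one_add_smul (secondMoment_isHermitian D) fun i =>
      lt_of_lt_of_le (by norm_num) (ht i), pow_mul_cfc]
  have e : ∀ A : Matrix (Fin P) (Fin P) ℝ, Aᵀ = A →
      (A *ᵥ β) ⬝ᵥ (secondMoment D *ᵥ (A *ᵥ β)) = β ⬝ᵥ ((A * secondMoment D * A) *ᵥ β) := by
    intro A hA
    rw [← mulVec_mulVec, ← mulVec_mulVec, dotProduct_mulVec β, ← mulVec_transpose, hA]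
  have hB : ((secondMoment_isHermitian D).cfc fun s => s ^ k * (1 / (1 + t * s))) * secondMoment D
        * ((secondMoment_isHermitian D).cfc fun s => s ^ k * (1 / (1 + t * s)))
      = (secondMoment_isHermitian D).cfc fun s =>
        s ^ k * (1 / (1 + t * s)) * s * (s ^ k * (1 / (1 + t * s))) := by
    have h := cfc_mul_cfc (secondMoment_isHermitian D) (fun s => s ^ k * (1 / (1 + t * s)))
      fun s => s
    rw [cfc_eq_self] at h
    rw [h, cfc_mul_cfc]
  rw [hA, e _ (transpose_cfc _ _), hB, dotProduct_cfc_eq, dotProduct_secondMoment_eq,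
    Finset.mul_sum]
  refine Finset.sum_le_sum fun i _ => ?_
  have h0 := popEigenvalue_nonneg hD i
  have h1 : (popEigenvalue D i ^ k) ^ 2 ≤ (opNorm (secondMoment D) ^ k) ^ 2 :=
    pow_le_pow_left₀ (by positivity) (pow_le_pow_left₀ h0 (popEigenvalue_le_opNorm hD i) k) 2
  have h2 : 1 / (1 + t * popEigenvalue D i) ≤ 2 := by
    rw [div_le_iff₀ (lt_of_lt_of_le (by norm_num) (ht i))]
    linarith [ht i]
  have h3 : 0 ≤ 1 / (1 + t * popEigenvalue D i) :=
    one_div_nonneg.2 (le_trans (by norm_num) (ht i))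
  have h4 : (1 / (1 + t * popEigenvalue D i)) ^ 2 ≤ 4 := by nlinarith
  have h5 := calc popEigenvalue D i ^ k * (1 / (1 + t * popEigenvalue D i)) * popEigenvalue D i
        * (popEigenvalue D i ^ k * (1 / (1 + t * popEigenvalue D i)))
      = (1 / (1 + t * popEigenvalue D i)) ^ 2 * (popEigenvalue D i ^ k) ^ 2
        * popEigenvalue D i := by ring
    _ ≤ 4 * (opNorm (secondMoment D) ^ k) ^ 2 * popEigenvalue D i := by gcongr
  have h6 := mul_le_mul_of_nonneg_right h5 (sq_nonneg (β ⬝ᵥ popEigenvector D i))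
  rwa [mul_assoc _ (popEigenvalue D i) (_ ^ 2)] at h6

/-! ### Probability estimates -/

section Probability

variable {P : ℕ} {D : Measure (Fin P → ℝ)} [IsProbabilityMeasure D]

instance (N : ℕ) : IsProbabilityMeasure (sampleLaw D N) := by
  unfold sampleLaw
  infer_instance

theorem integrable_empSecondMoment (hD : MemLp (fun x : Fin P → ℝ => x) 2 D) (N : ℕ)
    (u : Fin P → ℝ) : Integrable (fun X => u ⬝ᵥ (empSecondMoment X *ᵥ u)) (sampleLaw D N) := by
  simp only [← sum_sq_eq_empSecondMoment, sq]
  refine (integrable_finsetSum _ fun i _ => ?_).const_mul _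
  exact integrable_comp_eval (μ := fun _ : Fin N => D) (i := i) (integrable_dotProduct_mul hD u u)

theorem integral_empSecondMoment (hD : MemLp (fun x : Fin P → ℝ => x) 2 D) {N : ℕ} (hN : 0 < N)
    (u : Fin P → ℝ) :
    ∫ X, u ⬝ᵥ (empSecondMoment X *ᵥ u) ∂sampleLaw D N = u ⬝ᵥ (secondMoment D *ᵥ u) := by
  simp only [← sum_sq_eq_empSecondMoment, sq]
  have hi : ∀ i : Fin N, ∫ X : Fin N → Fin P → ℝ, (u ⬝ᵥ X i) * (u ⬝ᵥ X i) ∂sampleLaw D N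
      = u ⬝ᵥ (secondMoment D *ᵥ u) := fun i => by
    rw [← integral_dotProduct_mul hD]
    exact integral_comp_eval (μ := fun _ : Fin N => D) (i := i)
      (integrable_dotProduct_mul hD u u).aestronglyMeasurable
  have hint : ∀ i : Fin N,
      Integrable (fun X : Fin N → Fin P → ℝ => (u ⬝ᵥ X i) * (u ⬝ᵥ X i)) (sampleLaw D N) :=
    fun i => integrable_comp_eval (μ := fun _ : Fin N => D) (i := i)
      (integrable_dotProduct_mul hD u u)
  rw [integral_const_mul, integral_finsetSum _ fun i _ => hint i]
  simp only [hi, Finset.sum_const, Finset.card_univ, Fintype.card_fin, nsmul_eq_mul]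
  have : (N : ℝ) ≠ 0 := by exact_mod_cast hN.ne'
  field_simp

theorem empSecondMoment_nonneg {N : ℕ} (X : Fin N → Fin P → ℝ) (u : Fin P → ℝ) :
    0 ≤ u ⬝ᵥ (empSecondMoment X *ᵥ u) := by
  rw [← sum_sq_eq_empSecondMoment]
  positivity

/-- Markov's inequality; second moments suffice. -/
theorem measure_lt_empSecondMoment_le (hD : MemLp (fun x : Fin P → ℝ => x) 2 D) {N : ℕ}
    (hN : 0 < N) (u : Fin P → ℝ) {a : ℝ} (ha : 0 < a) :
    sampleLaw D N {X | a < u ⬝ᵥ (empSecondMoment X *ᵥ u)}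
      ≤ ENNReal.ofReal (u ⬝ᵥ (secondMoment D *ᵥ u) / a) := by
  have h := mul_meas_ge_le_integral_of_nonneg (μ := sampleLaw D N)
    (Eventually.of_forall fun X => empSecondMoment_nonneg X u)
    (integrable_empSecondMoment hD N u) a
  rw [integral_empSecondMoment hD hN, mul_comm, ← le_div_iff₀ ha] at h
  refine (measure_mono fun X hX => ?_).trans
    ((ENNReal.le_ofReal_iff_toReal_le (measure_ne_top _ _)
      (div_nonneg (dotProduct_secondMoment_nonneg hD u) ha.le)).2 h)
  exact (show a < _ from hX).le

/-- The degenerate case, where the claimed bound is zero. Almost surely `Σ̂β = 0`, hence `β - β̂ =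
β`, and both risks vanish. -/
theorem ae_risk_eq_omniRisk (hD : MemLp (fun x : Fin P → ℝ => x) 2 D) {N : ℕ} (hN : 0 < N)
    (β : Fin P → ℝ) {lam : ℝ} (hlam : 0 < lam) (hq : β ⬝ᵥ (secondMoment D *ᵥ β) = 0) :
    ∀ᵐ X ∂sampleLaw D N,
      omniRisk D β N lam = risk D β (ridgeEstimator X (labels β X) lam) := by
  have h1 := integral_empSecondMoment hD hN β
  rw [hq, integral_eq_zero_iff_of_nonneg (fun X => empSecondMoment_nonneg X β)
    (integrable_empSecondMoment hD N β)] at h1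
  have h2 : omniRisk D β N lam = 0 := by
    rw [dotProduct_secondMoment_eq, Finset.sum_eq_zero_iff_of_nonneg fun i _ =>
      mul_nonneg (popEigenvalue_nonneg hD i) (sq_nonneg _)] at hq
    rw [omniRisk, Finset.sum_eq_zero, mul_zero]
    intro i hi
    rw [div_mul_eq_mul_div, hq i hi, zero_div]
  filter_upwards [h1] with X hX
  have hX' : star β ⬝ᵥ (empSecondMoment X *ᵥ β) = 0 := by rw [star_trivial]; exact hX
  have h3 := ((empSecondMoment_posSemidef X).dotProduct_mulVec_zero_iff β).1 hX'
  have hpd := one_add_smul_empSecondMoment_posDef X (inv_pos.2 hlam).le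
  have h4 : (1 + lam⁻¹ • empSecondMoment X)⁻¹ *ᵥ β = β := by
    have : (1 + lam⁻¹ • empSecondMoment X) *ᵥ β = β := by
      rw [add_mulVec, one_mulVec, smul_mulVec, h3, smul_zero, add_zero]
    nth_rewrite 1 [← this]
    rw [mulVec_mulVec, Matrix.nonsing_inv_mul _ hpd.det_pos.ne'.isUnit, one_mulVec]
  rw [h2, risk_eq hD, sub_ridgeEstimator X β hlam, h4, hq]

end Probability

/-! ### Asymptotics -/

/-- A bound that holds with every exponent `-1/2 + η` holds with the exponent `-1/2 + o(1)`. -/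
theorem UnifLesssimRate.of_forall {Ω : ℕ → Type*} [∀ N, MeasurableSpace (Ω N)]
    {μ : ∀ N, Measure (Ω N)} {Z : Type*} {S : ℕ → Set Z} {f : ∀ N, Ω N → Z → ℝ} {g : ℕ → Z → ℝ}
    (h : ∀ η : ℝ, 0 < η → ∀ A : ℝ, 0 < A → ∃ N₀ : ℕ, ∀ N : ℕ, N₀ ≤ N →
      μ N {ω | ∀ z ∈ S N, f N ω z ≤ (N : ℝ) ^ (-(1 / 2) + η) * g N z}ᶜ
        ≤ ENNReal.ofReal ((N : ℝ) ^ (-A))) :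
    UnifLesssimRate μ S f g := by
  choose M hM using fun k : ℕ => h (1 / ((k : ℝ) + 1)) (by positivity) ((k : ℝ) + 1) (by positivity)
  -- Diagonal choice: `K N` is the largest admissible `k ≤ N` with `M k ≤ N`. It tends to infinity,
  -- so both the exponent loss `1 / (K N + 1)` vanishes and the probability exponent `K N + 1`
  -- exceeds every `A`.
  set K : ℕ → ℕ := fun N => Nat.findGreatest (fun k => M k ≤ N) N with hK
  have hKge : ∀ k N, M k ≤ N → k ≤ N → k ≤ K N := fun k N h1 h2 => Nat.le_findGreatest h2 h1
  have hKM : ∀ k N, M k ≤ N → k ≤ N → M (K N) ≤ N := fun k N h1 h2 =>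
    Nat.findGreatest_spec (P := fun k => M k ≤ N) h2 h1
  have hKlim : Tendsto K atTop atTop := tendsto_atTop.2 fun k => by
    filter_upwards [eventually_ge_atTop (max (M k) k)] with N hN
    exact hKge k N ((le_max_left _ _).trans hN) ((le_max_right _ _).trans hN)
  refine ⟨fun N => 1 / ((K N : ℝ) + 1), tendsto_one_div_add_atTop_nhds_zero_nat.comp hKlim, 1,
    one_pos, fun A hA => ?_⟩
  obtain ⟨k, hk⟩ := exists_nat_ge A
  refine ⟨max 1 (max (M k) k), fun N hN => ?_⟩
  have h1 : M k ≤ N := (le_max_left _ _).trans ((le_max_right _ _).trans hN)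
  have h2 : k ≤ N := (le_max_right _ _).trans ((le_max_right _ _).trans hN)
  have h3 : (1 : ℝ) ≤ N := by exact_mod_cast (le_max_left _ _).trans hN
  have h4 := hM (K N) N (hKM k N h1 h2)
  simp only [one_mul]
  refine h4.trans (ENNReal.ofReal_le_ofReal (Real.rpow_le_rpow_of_exponent_le h3 ?_))
  have : (k : ℝ) ≤ K N := by exact_mod_cast hKge k N h1 h2
  linarith

theorem eventually_const_le_rpow (C : ℝ) {η : ℝ} (hη : 0 < η) :
    ∀ᶠ N : ℕ in atTop, C ≤ (N : ℝ) ^ η :=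
  ((tendsto_rpow_atTop hη).comp tendsto_natCast_atTop_atTop).eventually_ge_atTop C

theorem sampleLaw_transformedLaw {P : ℕ} (D : Measure (Fin P → ℝ)) [IsProbabilityMeasure D] (t : ℝ)
    (N : ℕ) : sampleLaw (transformedLaw D t) N
      = (sampleLaw D N).map fun X i => whitener D t *ᵥ X i := by
  have hm : Measurable fun x : Fin P → ℝ => whitener D t *ᵥ x :=
    (Continuous.matrix_mulVec continuous_const continuous_id).measurable
  have : IsProbabilityMeasure (D.map fun x => whitener D t *ᵥ x) :=
    Measure.isProbabilityMeasure_map hm.aemeasurable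
  exact (Measure.pi_map_pi (μ := fun _ : Fin N => D) (f := fun _ x => whitener D t *ᵥ x)
    fun _ => hm.aemeasurable).symm

/-! ### The comparison with high probability. -/

section Main

variable {P : ℕ → ℕ} {D : ∀ N, Measure (Fin (P N) → ℝ)} [∀ N, IsProbabilityMeasure (D N)]
  {β : ∀ N, Fin (P N) → ℝ} {lam : ℕ → ℝ}

theorem dotProduct_smul_mulVec_smul {n : Type*} [Fintype n] (M : Matrix n n ℝ) (c : ℝ)
    (u : n → ℝ) : (c • u) ⬝ᵥ (M *ᵥ (c • u)) = c ^ 2 * (u ⬝ᵥ (M *ᵥ u)) := by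
  rw [mulVec_smul, smul_dotProduct, dotProduct_smul, smul_eq_mul, smul_eq_mul]
  ring

/-- The local law for one deterministic family `t`, as a comparison of quadratic forms of `β`. -/
theorem measure_node_le (hD : ∀ N, MemLp (fun x : Fin (P N) → ℝ => x) 2 (D N))
    (hlam : ∀ N, 0 < lam N)
    (hMP : ExtendedLocalMPLaw D fun N => Set.Ioo (1 / 2 * lam N) (3 / 2 * lam N))
    (t : ℕ → ℝ) (ht : ∀ N, |t N| * opNorm (secondMoment (D N)) < 1 / 2) {η A : ℝ} (hη : 0 < η)
    (hA : 0 < A) :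
    ∀ᶠ N : ℕ in atTop, 0 < β N ⬝ᵥ (secondMoment (D N) *ᵥ β N) →
      sampleLaw (D N) N {X | ¬ |∑ i, (β N ⬝ᵥ popEigenvector (D N) i) ^ 2
          / (1 + (t N + 1 / effectiveReg (transformedLaw (D N) (t N)) N (lam N))
            * popEigenvalue (D N) i)
        - β N ⬝ᵥ ((1 + t N • secondMoment (D N) + (lam N)⁻¹ • empSecondMoment X)⁻¹ *ᵥ β N)|
          ≤ 4 * (β N ⬝ᵥ (secondMoment (D N) *ᵥ β N)) / lam N * (N : ℝ) ^ (-(1 / 2) + η)}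
        ≤ ENNReal.ofReal ((N : ℝ) ^ (-A)) := by
  have hti := fun N => half_le_one_add_mul (hD N) (ht N).le
  set q : ℕ → ℝ := fun N => β N ⬝ᵥ (secondMoment (D N) *ᵥ β N) with hq
  have hq0 : ∀ N, 0 ≤ q N := fun N => dotProduct_secondMoment_nonneg (hD N) _
  have hsq : ∀ N, (2 * √(q N))⁻¹ ^ 2 = (4 * q N)⁻¹ := fun N => by
    rw [inv_pow, mul_pow, Real.sq_sqrt (hq0 N)]
    norm_num
  -- If `q N = 0`, the inverse is 0 by convention and the vector is zero, so the family is
  -- admissible for every `N`.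
  have hv : ∀ N, ((2 * √(q N))⁻¹ • (whitener (D N) (t N) *ᵥ β N)) ⬝ᵥ
      (secondMoment (transformedLaw (D N) (t N)) *ᵥ
        ((2 * √(q N))⁻¹ • (whitener (D N) (t N) *ᵥ β N))) ≤ 1 := by
    intro N
    rw [dotProduct_smul_mulVec_smul, hsq]
    have h := mul_le_mul_of_nonneg_left (whitened_variance_le (hD N) (hti N) (β N))
      (inv_nonneg.2 (mul_nonneg (by norm_num : (0 : ℝ) ≤ 4) (hq0 N)))
    exact h.trans (inv_mul_le_one)
  obtain ⟨ε, hε, C, hC, hW⟩ := (hMP t ht _ hv).2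
  obtain ⟨N₁, hN₁⟩ := hW A hA
  filter_upwards [eventually_ge_atTop N₁, eventually_ge_atTop 1,
    hε.eventually (gt_mem_nhds (half_pos hη)), eventually_const_le_rpow C (half_pos hη)]
    with N h1 h2 h3 h4 hqN
  have h2' : (1 : ℝ) ≤ N := by exact_mod_cast h2
  have h := hN₁ N h1
  beta_reduce at h
  rw [sampleLaw_transformedLaw] at h
  have hm : Measurable fun (X : Fin N → Fin (P N) → ℝ) i => whitener (D N) (t N) *ᵥ X i :=
    (continuous_pi fun i =>
      Continuous.matrix_mulVec continuous_const (continuous_apply i)).measurable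
  -- The pushforward inequality used here holds without measurability of the event.
  refine (measure_mono ?_).trans ((Measure.le_map_apply hm.aemeasurable _).trans h)
  intro X hX
  rw [Set.mem_preimage, Set.mem_compl_iff]
  intro hgood
  refine hX ?_
  have hg := hgood (lam N) ⟨by linarith [hlam N], by linarith [hlam N]⟩
  have hk := (isFixedInv_effectiveReg (hD N) (hti N) N (hlam N)).1
  simp only [dotProduct_smul_mulVec_smul] at hg
  rw [hsq, empSecondMoment_mulVec, transpose_whitener, population_quadraticForm (hD N) (hti N) hk,
    whitened_quadraticForm (t N) (hti N) (hlam N), ← mul_sub, abs_mul,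
    abs_of_pos (inv_pos.2 (mul_pos (by norm_num : (0 : ℝ) < 4) hqN)),
    inv_mul_le_iff₀ (mul_pos (by norm_num : (0 : ℝ) < 4) hqN)] at hg
  refine hg.trans ?_
  have hsc := errorScale_le (hD N) (hti N) N (hlam N)
  have hrate : C * (N : ℝ) ^ (-(1 / 2) + ε N) ≤ (N : ℝ) ^ (-(1 / 2) + η) := by
    have e : -(1 / 2) + η = η / 2 + (-(1 / 2) + η / 2) := by ring
    rw [e, Real.rpow_add (show (0 : ℝ) < N by linarith) (η / 2)]
    refine mul_le_mul h4 (Real.rpow_le_rpow_of_exponent_le h2' (by linarith)) (by positivity)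
      (by positivity)
  calc 4 * q N * (C * ((N : ℝ) ^ (-(1 / 2) + ε N)
        * (1 / effectiveReg (transformedLaw (D N) (t N)) N (lam N)
          * √(effectiveRegDeriv (transformedLaw (D N) (t N)) N (lam N)))))
      ≤ 4 * q N * (C * ((N : ℝ) ^ (-(1 / 2) + ε N) * (1 / lam N))) := by gcongr
    _ = 4 * q N / lam N * (C * (N : ℝ) ^ (-(1 / 2) + ε N)) := by ring
    _ ≤ 4 * q N / lam N * (N : ℝ) ^ (-(1 / 2) + η) :=
      mul_le_mul_of_nonneg_left hrate (div_nonneg (by linarith [hq0 N]) (hlam N).le)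

/-- Markov's inequality at the level `N ^ A` times the bound of `node_variance_le` on the mean. -/
theorem measure_moment_le {P N : ℕ} {D : Measure (Fin P → ℝ)} [IsProbabilityMeasure D]
    (hD : MemLp (fun x : Fin P → ℝ => x) 2 D) (hN : 0 < N) {β : Fin P → ℝ} {lam t A : ℝ}
    (hlam : 0 < lam) (hs : 0 < opNorm (secondMoment D))
    (hq : 0 < β ⬝ᵥ (secondMoment D *ᵥ β))
    (ht : ∀ i, 1 / 2 ≤ 1 + t * popEigenvalue D i) (k : ℕ) :
    sampleLaw D N {X | ¬ ((secondMoment D ^ k * (1 + t • secondMoment D)⁻¹) *ᵥ β) ⬝ᵥ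
        ((lam⁻¹ • empSecondMoment X) *ᵥ
          ((secondMoment D ^ k * (1 + t • secondMoment D)⁻¹) *ᵥ β))
        ≤ (4 * (β ⬝ᵥ (secondMoment D *ᵥ β)) / lam * (N : ℝ) ^ A)
          * (opNorm (secondMoment D) ^ k) ^ 2}
      ≤ ENNReal.ofReal ((N : ℝ) ^ (-A)) := by
  set u := (secondMoment D ^ k * (1 + t • secondMoment D)⁻¹) *ᵥ β with hu
  set q := β ⬝ᵥ (secondMoment D *ᵥ β) with hqdef
  set s := opNorm (secondMoment D) with hsdef
  have hN' : (0 : ℝ) < N := by exact_mod_cast hN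
  have hNA : 0 < (N : ℝ) ^ A := Real.rpow_pos_of_pos hN' A
  have ha : 0 < 4 * q * (N : ℝ) ^ A * (s ^ k) ^ 2 := by positivity
  refine (measure_mono fun X hX => ?_).trans
    ((measure_lt_empSecondMoment_le hD hN u ha).trans (ENNReal.ofReal_le_ofReal ?_))
  · have hX' := not_le.1 (show ¬ _ from hX)
    rw [smul_mulVec, dotProduct_smul, smul_eq_mul, lt_inv_mul_iff₀ hlam] at hX'
    refine lt_of_eq_of_lt ?_ hX'
    field_simp
  · rw [div_le_iff₀ ha, Real.rpow_neg hN'.le]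
    refine (node_variance_le hD β ht k).trans_eq ?_
    rw [← hsdef, ← hqdef]
    field_simp

theorem opNorm_pos_of_pos {P : ℕ} {D : Measure (Fin P → ℝ)}
    (hD : MemLp (fun x : Fin P → ℝ => x) 2 D) {β : Fin P → ℝ}
    (hq : 0 < β ⬝ᵥ (secondMoment D *ᵥ β)) : 0 < opNorm (secondMoment D) := by
  by_contra! h
  refine hq.ne' ?_
  rw [dotProduct_secondMoment_eq]
  refine Finset.sum_eq_zero fun i _ => ?_
  rw [le_antisymm ((popEigenvalue_le_opNorm hD i).trans h) (popEigenvalue_nonneg hD i), zero_mul]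

theorem measure_abs_omniRisk_sub_risk_le
    (hD : ∀ N, MemLp (fun x : Fin (P N) → ℝ => x) 2 (D N)) (hlam : ∀ N, 0 < lam N)
    (hMP : ExtendedLocalMPLaw D fun N => Set.Ioo (1 / 2 * lam N) (3 / 2 * lam N))
    {η A : ℝ} (hη : 0 < η) (hA : 0 < A) :
    ∀ᶠ N : ℕ in atTop, sampleLaw (D N) N
      {X | ¬ |omniRisk (D N) (β N) N (lam N)
          - risk (D N) (β N) (ridgeEstimator X (labels (β N) X) (lam N))|
        ≤ (N : ℝ) ^ (-(1 / 2) + η) * (β N ⬝ᵥ (secondMoment (D N) *ᵥ β N)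
          * (opNorm (secondMoment (D N)) / lam N))} ≤ ENNReal.ofReal ((N : ℝ) ^ (-A)) := by
  -- Chosen so that `N ^ (A + 1) * x ^ n ≤ N ^ (-1/2)` for `x = N ^ (-η/4)`: the Taylor remainder
  -- absorbs the loss in Markov's inequality.
  obtain ⟨n₀, hn₀⟩ := exists_nat_ge ((A + 1 + 1 / 2) / (η / 4))
  set n := max 2 n₀ with hndef
  have hn : 2 ≤ n := le_max_left _ _
  have hnη : A + 1 + 1 / 2 ≤ η / 4 * n := by
    rw [div_le_iff₀ (by positivity)] at hn₀
    have : (n₀ : ℝ) ≤ n := by exact_mod_cast le_max_right 2 n₀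
    nlinarith
  obtain ⟨C, hC0, hC⟩ := exists_nodes_const (⟨1, hn⟩ : Fin n)
  set x : ℕ → ℝ := fun N => (N : ℝ) ^ (-(η / 4)) with hx
  -- If the operator norm is 0, division by zero makes all nodes 0, which is still admissible in the
  -- extended law.
  set t : Fin n → ℕ → ℝ := fun j N => j * (x N / (4 * n * opNorm (secondMoment (D N)))) with htdef
  have hx0 : ∀ N, 0 ≤ x N := fun N => Real.rpow_nonneg N.cast_nonneg _
  have hx1 : ∀ N, x N ≤ 1 := by
    intro N
    rcases Nat.eq_zero_or_pos N with rfl | hN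
    · simp only [hx, Nat.cast_zero]
      rw [Real.zero_rpow (by linarith)]
      exact zero_le_one
    · exact Real.rpow_le_one_of_one_le_of_nonpos (by exact_mod_cast hN) (by linarith)
  have hs0 : ∀ N, 0 ≤ opNorm (secondMoment (D N)) := fun N => norm_nonneg _
  have hn0 : (0 : ℝ) < n := by exact_mod_cast (by omega : 0 < n)
  have hts : ∀ j N, |t j N| * opNorm (secondMoment (D N)) < 1 / 2 := by
    intro j N
    rw [htdef, abs_of_nonneg (mul_nonneg (Nat.cast_nonneg _)
      (div_nonneg (hx0 N) (mul_nonneg (by positivity) (hs0 N))))]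
    rcases (hs0 N).eq_or_lt with h | h
    · rw [← h, mul_zero]
      norm_num
    · have e : (j : ℝ) * (x N / (4 * n * opNorm (secondMoment (D N))))
          * opNorm (secondMoment (D N)) = j / n * (x N / 4) := by
        field_simp
      have h1 : (j : ℝ) / n ≤ 1 := div_le_one_of_le₀ (by exact_mod_cast j.2.le) hn0.le
      simp only [e]
      nlinarith [hx0 N, hx1 N, mul_le_mul_of_nonneg_right h1 (hx0 N)]
  have hnodes : ∀ᶠ N : ℕ in atTop, ∀ j : Fin n, _ := eventually_all.2 fun j =>
    measure_node_le (β := β) hD hlam hMP (t j) (hts j) (η := η / 4) (A := A + 1) (by positivity)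
      (by positivity)
  filter_upwards [hnodes, eventually_ge_atTop 1, eventually_ge_atTop ((n + 1) * n + n),
    eventually_const_le_rpow (C * (4 * n) * (4 + ((n + 1) * (n + 2) * 4 + 8))) (half_pos hη)]
    with N hN hN1 hNn hNC
  have hN1' : (1 : ℝ) ≤ N := by exact_mod_cast hN1
  have hN0 : (0 : ℝ) < N := by linarith
  have hq0 := dotProduct_secondMoment_nonneg (hD N) (β N)
  rcases hq0.eq_or_lt with hq | hq
  · refine le_trans (le_of_eq ?_) zero_le
    rw [← ae_iff]
    filter_upwards [ae_risk_eq_omniRisk (hD N) hN1 (β N) (hlam N) hq.symm] with X hX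
    rw [hX, sub_self, abs_zero, ← hq, zero_mul, mul_zero]
  have hs := opNorm_pos_of_pos (hD N) hq
  have hxN : 0 < x N := Real.rpow_pos_of_pos hN0 _
  set q := β N ⬝ᵥ (secondMoment (D N) *ᵥ β N) with hqdef
  set s := opNorm (secondMoment (D N)) with hsdef
  set w := 4 * q / lam N * (N : ℝ) ^ (A + 1) with hw
  have hti : ∀ j i, 1 / 2 ≤ 1 + t j N * popEigenvalue (D N) i := fun j =>
    half_le_one_add_mul (hD N) (hts j N).le
  have hl := hlam N
  let bad₁ : Fin n → Set (Fin N → Fin (P N) → ℝ) := fun j =>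
    {X | ¬ |∑ i, (β N ⬝ᵥ popEigenvector (D N) i) ^ 2
          / (1 + (t j N + 1 / effectiveReg (transformedLaw (D N) (t j N)) N (lam N))
            * popEigenvalue (D N) i)
        - β N ⬝ᵥ ((1 + t j N • secondMoment (D N) + (lam N)⁻¹ • empSecondMoment X)⁻¹ *ᵥ β N)|
          ≤ 4 * q / lam N * (N : ℝ) ^ (-(1 / 2) + η / 4)}
  let bad₂ : Fin (n + 1) × Fin n → Set (Fin N → Fin (P N) → ℝ) := fun p =>
    {X | ¬ ((secondMoment (D N) ^ (p.1 : ℕ) * (1 + t p.2 N • secondMoment (D N))⁻¹) *ᵥ β N) ⬝ᵥ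
        (((lam N)⁻¹ • empSecondMoment X) *ᵥ
          ((secondMoment (D N) ^ (p.1 : ℕ) * (1 + t p.2 N • secondMoment (D N))⁻¹) *ᵥ β N))
        ≤ w * (s ^ (p.1 : ℕ)) ^ 2}
  have hbad₁ : ∀ j, sampleLaw (D N) N (bad₁ j) ≤ ENNReal.ofReal ((N : ℝ) ^ (-(A + 1))) :=
    fun j => hN j hq
  have hbad₂ : ∀ p, sampleLaw (D N) N (bad₂ p) ≤ ENNReal.ofReal ((N : ℝ) ^ (-(A + 1))) :=
    fun p => measure_moment_le (hD N) hN1 hl hs hq (hti p.2) p.1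
  have hsub : {X | ¬ |omniRisk (D N) (β N) N (lam N)
          - risk (D N) (β N) (ridgeEstimator X (labels (β N) X) (lam N))|
        ≤ (N : ℝ) ^ (-(1 / 2) + η) * (q * (s / lam N))} ⊆ (⋃ p, bad₂ p) ∪ ⋃ j, bad₁ j := by
    intro X hX
    by_contra hcon
    rw [Set.mem_union, not_or, Set.mem_iUnion, Set.mem_iUnion, not_exists, not_exists] at hcon
    refine hX ?_
    have hmain := abs_omniRisk_sub_risk_le hn hC (hD N) X (β N) (t := fun j => t j N)
      (δ := 4 * q / lam N * (N : ℝ) ^ (-(1 / 2) + η / 4)) (w := w) hl (by positivity) hs hxN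
      (hx1 N) (fun j => rfl) (fun j => not_not.1 (hcon.2 j))
      (fun k hk j => not_not.1 (hcon.1 (⟨k, Nat.lt_succ_of_le hk⟩, j)))
    refine hmain.trans ?_
    rw [← hqdef, ← hsdef]
    set r := (N : ℝ) ^ (-(1 / 2) + η / 4) with hr
    have hr0 : 0 < r := Real.rpow_pos_of_pos hN0 _
    have hxn : x N ^ n = (N : ℝ) ^ (-(η / 4) * n) := by
      rw [hx, ← Real.rpow_natCast, ← Real.rpow_mul hN0.le]
    have hb1 : (N : ℝ) ^ (A + 1) * x N ^ n ≤ r := by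
      rw [hxn, ← Real.rpow_add hN0]
      exact Real.rpow_le_rpow_of_exponent_le hN1' (by linarith)
    have hb2 : x N ^ n ≤ r := by
      refine le_trans ?_ hb1
      exact le_mul_of_one_le_left (pow_nonneg hxN.le n)
        (Real.one_le_rpow hN1' (by linarith))
    -- The budget for `η`: `η/4` from the node spacing, `η/4` from the law, and `η/2` for the
    -- constants.
    have hxr : 1 / x N * r * (N : ℝ) ^ (η / 2) = (N : ℝ) ^ (-(1 / 2) + η) := by
      rw [hx, hr, one_div, ← Real.rpow_neg hN0.le, ← Real.rpow_add hN0, ← Real.rpow_add hN0]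
      congr 1
      ring
    calc C * (4 * n * s / x N) * (4 * q / lam N * r + ((n + 1) * (n + 2) * w + 8 * q / lam N)
          * x N ^ n)
        = C * (4 * n) * (1 / x N) * (q * (s / lam N)) * (4 * r
          + ((n + 1) * (n + 2) * 4 * ((N : ℝ) ^ (A + 1) * x N ^ n) + 8 * x N ^ n)) := by
          rw [hw]
          ring
      _ ≤ C * (4 * n) * (1 / x N) * (q * (s / lam N)) * (4 * r
          + ((n + 1) * (n + 2) * 4 * r + 8 * r)) := by gcongr
      _ = (1 / x N) * r * (C * (4 * n) * (4 + ((n + 1) * (n + 2) * 4 + 8)))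
          * (q * (s / lam N)) := by ring
      _ ≤ (1 / x N) * r * (N : ℝ) ^ (η / 2) * (q * (s / lam N)) := by gcongr
      _ = (N : ℝ) ^ (-(1 / 2) + η) * (q * (s / lam N)) := by rw [hxr]
  refine (measure_mono hsub).trans ((measure_union_le _ _).trans ?_)
  refine (add_le_add ((measure_iUnion_fintype_le _ _).trans (Finset.sum_le_sum fun p _ => hbad₂ p))
    ((measure_iUnion_fintype_le _ _).trans (Finset.sum_le_sum fun j _ => hbad₁ j))).trans ?_
  rw [Finset.sum_const, Finset.sum_const, ← add_nsmul, Finset.card_univ, Finset.card_univ,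
    Fintype.card_prod, Fintype.card_fin, Fintype.card_fin, nsmul_eq_mul]
  -- There are `(n + 1) n + n` bad events, each of probability at most `N ^ (-(A + 1))`; their
  -- number is absorbed by one factor `N`.
  have hcast : (((n + 1) * n + n : ℕ) : ENNReal) ≤ ENNReal.ofReal (N : ℝ) := by
    rw [ENNReal.ofReal_natCast]
    exact_mod_cast hNn
  refine (mul_le_mul_left hcast _).trans ?_
  rw [← ENNReal.ofReal_mul hN0.le]
  refine ENNReal.ofReal_le_ofReal (le_of_eq ?_)
  nth_rewrite 1 [← Real.rpow_one (N : ℝ)]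
  rw [← Real.rpow_add hN0]
  congr 1
  ring

end Main

end RidgeRisk

theorem mainTheorem3 (P : ℕ → ℕ) (D : ∀ N, MeasureTheory.Measure (Fin (P N) → ℝ))
    [∀ N, MeasureTheory.IsProbabilityMeasure (D N)]
    (hD : ∀ N, MeasureTheory.MemLp (fun x : Fin (P N) → ℝ => x) 2 (D N))
    (β : ∀ N, Fin (P N) → ℝ) (lam : ℕ → ℝ) (hlam : ∀ N, 0 < lam N)
    (hMP : RidgeRisk.ExtendedLocalMPLaw D
      fun N => Set.Ioo (1 / 2 * lam N) (3 / 2 * lam N)) :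
    RidgeRisk.UnifLesssimRate (fun N => RidgeRisk.sampleLaw (D N) N) (fun N => {lam N})
      (fun N X l => |RidgeRisk.omniRisk (D N) (β N) N l
        - RidgeRisk.risk (D N) (β N)
            (RidgeRisk.ridgeEstimator X (RidgeRisk.labels (β N) X) l)|)
      (fun N l => β N ⬝ᵥ (RidgeRisk.secondMoment (D N) *ᵥ β N)
        * (RidgeRisk.opNorm (RidgeRisk.secondMoment (D N)) / l)) := by
  refine RidgeRisk.UnifLesssimRate.of_forall fun η hη A hA => ?_
  obtain ⟨N₀, h⟩ := Filter.eventually_atTop.1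
    (RidgeRisk.measure_abs_omniRisk_sub_risk_le (β := β) hD hlam hMP hη hA)
  refine ⟨N₀, fun N hN => (MeasureTheory.measure_mono fun X hX => ?_).trans (h N hN)⟩
  intro hX'
  refine hX fun z hz => ?_
  rw [Set.mem_singleton_iff.1 hz]
  exact hX'
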